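/- Let $M$ be a von Neumann algebra with a faithful normal tracial state $\varphi$. Let $X,Y\in M$ be self-adjoint, positive and invertible, free with respect to $\varphi$, and non-degenerate (their distributions are not point masses). Set $U=(X+Y)^{-1}$ and $V=X^{-1}-(X+Y)^{-1}$, and let $\varphi(\cdot\,|\,U)$ be the $\varphi$-preserving conditional expectation of $M$ onto the von Neumann subalgebra generated by $U$ and the identity $\mathbb I$. Assume that for some real constants $c,d$ $$\varphi(V\,|\,U)=c\,\mathbb I,\qquad \varphi(V^{-1}\,|\,U)=d\,\mathbb I .$$ Then $cd>1$, $\delta_0:=\varphi(Y^{-1})>0$, and with $$\lambda=\frac{cd}{cd-1},\qquad \alpha=\frac{\delta_0}{cd-1},\qquad \beta=\frac{d}{cd-1}$$ (so that $\lambda>1$ and $\alpha,\beta>0$) the following hold. (i) $Y$ has the free Poisson (Marchenko--Pastur) distribution with rate $\lambda$ and jump size $1/\alpha$. Here the free Poisson distribution with rate $\lambda\ge 0$ and jump size $\gamma>0$ is the measure $\max\{0,1-\lambda\}\,\delta_{\{0\}}+\tilde\nu$, where $\delta_{\{0\}}$ is the unit mass at $0$ and $\tilde\nu$ is the measure on $\left(\gamma(1-\sqrt\lambda)^2,\gamma(1+\sqrt\lambda)^2\right)$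 with density $\frac{1}{2\pi\gamma x}\sqrt{4\lambda\gamma^2-(x-\gamma(1+\lambda))^2}$. (ii) $X$ has the free GIG distribution $\mu(-\lambda,\alpha,\beta)$. Here, for $\kappa\in\mathbb R$ and $\alpha,\beta>0$, $\mu(\kappa,\alpha,\beta)$ is the measure on $[a,b]$ with density $$\frac{1}{2\pi}\sqrt{(x-a)(b-x)}\left(\frac{\alpha}{x}+\frac{\beta}{\sqrt{ab}\,x^2}\right),$$ where $0<a<b$ solve $$1-\kappa+\alpha\sqrt{ab}-\beta\,\frac{a+b}{2ab}=0,\qquad 1+\kappa+\frac{\beta}{\sqrt{ab}}-\alpha\,\frac{a+b}{2}=0 .$$ The distribution of a self-adjoint $Z\in M$ is the compactly supported probability measure on $\mathbb R$ whose $n$-th moment is $\varphi(Z^n)$ for every $n\ge 0$. -/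

import Mathlib

open MeasureTheory
open scoped ComplexOrder

noncomputable section

namespace FreeMY

section State

variable {A : Type*} [Ring A] [StarRing A] [Algebra ℂ A] [PartialOrder A]

/-- A faithful normal tracial state. Normality is preservation of suprema of increasing nets
of positive elements. -/
structure IsFaithfulNormalTracialState (φ : A →ₗ[ℂ] ℂ) : Prop where
  map_one : φ 1 = 1
  nonneg : ∀ a : A, 0 ≤ a → 0 ≤ φ a
  faithful : ∀ a : A, φ (star a * a) = 0 → a = 0
  tracial : ∀ a b : A, φ (a * b) = φ (b * a)
  normal : ∀ (D : Set A) (x : A), D.Nonempty → DirectedOn (· ≤ ·) D → (∀ a ∈ D, 0 ≤ a) →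
    IsLUB D x → IsLUB ((fun a => (φ a).re) '' D) (φ x).re

end State

section Freeness

variable {A : Type*} [Ring A] [Algebra ℂ A]

/-- Freeness of a family of unital subalgebras: an alternating product of at least one centred
factor is centred. -/
def FreeSubalgebras {ι : Type*} (φ : A →ₗ[ℂ] ℂ) (B : ι → Subalgebra ℂ A) : Prop :=
  ∀ (n : ℕ) (j : Fin (n + 1) → ι) (a : Fin (n + 1) → A),
    (∀ i, a i ∈ B (j i)) → (∀ i, φ (a i) = 0) →
    (∀ i : Fin n, j i.castSucc ≠ j i.succ) →
    φ (List.ofFn a).prod = 0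

/-- Two random variables are free if the unital algebras they generate are free
(used for self-adjoint variables). -/
def Free (φ : A →ₗ[ℂ] ℂ) (X Y : A) : Prop :=
  FreeSubalgebras φ ![Algebra.adjoin ℂ {X}, Algebra.adjoin ℂ {Y}]

/-- `μ` is the distribution of the (self-adjoint) variable `X`: the compactly supported
probability measure on the line with the moments of `X`. -/
structure HasDistribution (φ : A →ₗ[ℂ] ℂ) (X : A) (μ : Measure ℝ) : Prop where
  isProbabilityMeasure : IsProbabilityMeasure μ
  compactSupport : ∃ K : Set ℝ, IsCompact K ∧ μ Kᶜ = 0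
  moments : ∀ n : ℕ, φ (X ^ n) = ((∫ t, t ^ n ∂μ : ℝ) : ℂ)

/-- The distribution of `X` is not a point mass. -/
def NonDegenerate (φ : A →ₗ[ℂ] ℂ) (X : A) : Prop :=
  ∀ r : ℝ, ¬ HasDistribution φ X (Measure.dirac r)

end Freeness

section ConditionalExpectation

variable {H : Type*} [NormedAddCommGroup H] [InnerProductSpace ℂ H] [CompleteSpace H]

/-- The von Neumann algebra generated by an operator `T` and the identity, that is, the double
commutant of `{T, T*}`. -/
def generatedBy (T : H →L[ℂ] H) : VonNeumannAlgebra H where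
  toStarSubalgebra :=
    StarSubalgebra.centralizer ℂ (StarSubalgebra.centralizer ℂ {T} : Set (H →L[ℂ] H))
  centralizer_centralizer' := by simp

/-- `E` is the `φ`-preserving conditional expectation of the von Neumann algebra `M` onto its
von Neumann subalgebra `N`: a positive `N`-bimodule projection of `M` onto `N` with `φ ∘ E = φ`.
For a faithful normal tracial state `φ` there is exactly one such map, and it is faithful
and normal. -/
structure IsCondExp {M : VonNeumannAlgebra H} (φ : M.toStarSubalgebra →ₗ[ℂ] ℂ)
    (N : VonNeumannAlgebra H) (E : M.toStarSubalgebra →ₗ[ℂ] M.toStarSubalgebra) : Prop where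
  le : N ≤ M
  mem : ∀ a, (E a : H →L[ℂ] H) ∈ N
  proj : ∀ b : M.toStarSubalgebra, (b : H →L[ℂ] H) ∈ N → E b = b
  nonneg : ∀ a, 0 ≤ a → 0 ≤ E a
  bimodule : ∀ b₁ a b₂ : M.toStarSubalgebra, (b₁ : H →L[ℂ] H) ∈ N → (b₂ : H →L[ℂ] H) ∈ N →
    E (b₁ * a * b₂) = b₁ * E a * b₂
  preserves : ∀ a, φ (E a) = φ a

end ConditionalExpectation

/-- The Marchenko–Pastur (free Poisson) distribution with the given rate and jump size: an atom
of mass `max(0, 1 - rate)` at `0` and an absolutely continuous part. -/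
def freePoisson (rate jump : ℝ) : Measure ℝ :=
  ENNReal.ofReal (max 0 (1 - rate)) • Measure.dirac 0 +
    (volume.restrict
      (Set.Ioo (jump * (1 - √rate) ^ 2) (jump * (1 + √rate) ^ 2))).withDensity
      fun x => ENNReal.ofReal
        (1 / (2 * Real.pi * jump * x) * √(4 * rate * jump ^ 2 - (x - jump * (1 + rate)) ^ 2))

/-- `μ` is the free generalized inverse Gaussian distribution with parameters `lam`, `α`, `β`. -/
def IsFreeGIG (μ : Measure ℝ) (lam α β : ℝ) : Prop :=
  0 < α ∧ 0 < β ∧ ∃ a b : ℝ, 0 < a ∧ a < b ∧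
    1 - lam + α * √(a * b) - β * ((a + b) / (2 * (a * b))) = 0 ∧
    1 + lam + β / √(a * b) - α * ((a + b) / 2) = 0 ∧
    μ = (volume.restrict (Set.Icc a b)).withDensity fun x => ENNReal.ofReal
      (1 / (2 * Real.pi) * √((x - a) * (b - x)) * (α / x + β / (√(a * b) * x ^ 2)))

end FreeMY

end

/-!
Freeness enters through subordination. Write `M_Z(u) = φ((1 - uZ)⁻¹)` and choose `v` near `0` with
`v M_Y(v) = u M_X(u) =: g`. Then the normalized resolvents `R_X = (1 - uX)⁻¹ / M_X(u)` and
`R_Y = (1 - vY)⁻¹ / M_Y(v)` satisfy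
`R_X⁻¹ + R_Y⁻¹ - 1 = M_X(u) + M_Y(v) - 1 - g(X + Y)`. Expanding the inverse `R` of this element into
alternating products of the centred elements `R_X - 1` and `R_Y - 1` shows that `R_X` and `R_Y` are
the conditional expectations of `R` given `X` and `Y`.

Testing the regression of `V = X⁻¹ - (X + Y)⁻¹` against `R` computes `φ(X⁻¹ R)`. As
`V⁻¹ = X Y⁻¹ (X + Y)`, testing that of `V⁻¹` against `(X + Y)⁻² R` computes `φ(Y⁻¹ R)` by
traciality. Eliminating the mixed moments leaves one quadratic equation for `M_X` and one for `M_Y`.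

The equation for `M_Y` is that of the free Poisson law. The equation for `M_X` still contains the
unknown `φ(X⁻¹)`, but `M_X` is analytic on the negative axis, so the discriminant is a square there.
It vanishes at some point, which is thus a double root; this determines the unknown and identifies
the free GIG law.
-/

noncomputable section

namespace FreeMY

open Filter Topology
open scoped Ring

section State

variable {A : Type*} [Ring A] [Algebra ℂ A] [PartialOrder A]

/-- A state: a normalised positive linear functional. -/
structure IsState (φ : A →ₗ[ℂ] ℂ) : Prop where
  map_one : φ 1 = 1
  nonneg : ∀ a : A, 0 ≤ a → 0 ≤ φ a

theorem IsFaithfulNormalTracialState.isState [StarRing A] {φ : A →ₗ[ℂ] ℂ}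
    (hφ : IsFaithfulNormalTracialState φ) : IsState φ :=
  ⟨hφ.map_one, hφ.nonneg⟩

theorem IsState.nontrivial {φ : A →ₗ[ℂ] ℂ} (hφ : IsState φ) : Nontrivial A :=
  ⟨1, 0, fun h => by simpa [h] using hφ.map_one⟩

end State

section CStarState

variable {A : Type*} [CStarAlgebra A] [PartialOrder A] {φ : A →ₗ[ℂ] ℂ}

theorem IsState.map_algebraMap (hφ : IsState φ) (r : ℝ) : φ (algebraMap ℝ A r) = r := by
  rw [Algebra.algebraMap_eq_smul_one, φ.map_smul_of_tower, hφ.map_one, Complex.real_smul, mul_one]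

variable [StarOrderedRing A]

theorem IsState.mono (hφ : IsState φ) {a b : A} (h : a ≤ b) : φ a ≤ φ b := by
  simpa only [map_sub, sub_nonneg] using hφ.nonneg (b - a) (sub_nonneg.2 h)

theorem IsState.re_mono (hφ : IsState φ) {a b : A} (h : a ≤ b) : (φ a).re ≤ (φ b).re :=
  (Complex.le_def.1 (hφ.mono h)).1

theorem IsState.continuous (hφ : IsState φ) : Continuous φ := by
  obtain ⟨C, hC⟩ := (PositiveLinearMap.mk₀ φ hφ.nonneg).exists_norm_apply_le
  exact AddMonoidHomClass.continuous_of_bound φ C hC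

theorem IsState.eq_re_of_isSelfAdjoint (hφ : IsState φ) {a : A} (ha : IsSelfAdjoint a) :
    φ a = ((φ a).re : ℂ) := by
  have h := hφ.mono ha.le_algebraMap_norm_self
  rw [hφ.map_algebraMap] at h
  exact Complex.ext rfl (Complex.le_def.1 h).2

theorem star_one_sub_smul_inverse_mul_mul {a : A} (ha : IsStrictlyPositive a) (t : ℝ) :
    star (1 - t • a⁻¹ʳ) * a * (1 - t • a⁻¹ʳ) = a - (2 * t) • 1 + (t * t) • a⁻¹ʳ := by
  simp only [star_sub, star_one, star_smul, star_trivial,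
    ha.ringInverse.isSelfAdjoint.star_eq, sub_mul, mul_sub, one_mul, mul_one,
    smul_mul_assoc, mul_smul_comm, Ring.inverse_mul_cancel _ ha.isUnit,
    Ring.mul_inverse_cancel _ ha.isUnit]
  module

theorem IsState.one_le_mul_inverse (hφ : IsState φ) {a : A} (ha : IsStrictlyPositive a) :
    1 ≤ (φ a).re * (φ a⁻¹ʳ).re := by
  have hquad : ∀ t : ℝ, 0 ≤ (φ a⁻¹ʳ).re * (t * t) + (-2) * t + (φ a).re := by
    intro t
    have h := (Complex.le_def.1 (hφ.nonneg _
      (star_left_conjugate_nonneg ha.nonneg (1 - t • a⁻¹ʳ)))).1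
    rw [star_one_sub_smul_inverse_mul_mul ha, map_add, map_sub, φ.map_smul_of_tower,
      φ.map_smul_of_tower, hφ.map_one] at h
    simp only [Complex.add_re, Complex.sub_re, Complex.smul_re, Complex.one_re, Complex.zero_re,
      smul_eq_mul] at h
    linarith
  have hdiscrim := discrim_le_zero hquad
  rw [discrim] at hdiscrim
  linarith

theorem IsState.re_pos (hφ : IsState φ) {a : A} (ha : IsStrictlyPositive a) : 0 < (φ a).re := by
  have h0 : 0 ≤ (φ a).re := (Complex.le_def.1 (hφ.nonneg a ha.nonneg)).1
  refine h0.lt_of_ne fun h => ?_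
  have := hφ.one_le_mul_inverse ha
  rw [← h, zero_mul] at this
  exact not_le_of_gt one_pos this

end CStarState

section Words

variable {A : Type*} [NormedRing A] [NormedAlgebra ℂ A] {ι : Type*} {φ : A →ₗ[ℂ] ℂ}
  {B : ι → Subalgebra ℂ A}

theorem FreeSubalgebras.topologicalClosure (h : FreeSubalgebras φ B) (hφ : Continuous φ)
    (h1 : φ 1 = 1) : FreeSubalgebras φ fun i => (B i).topologicalClosure := by
  intro n j a ha hφa hj
  have hcentred : ∀ i, a i ∈ closure {b | b ∈ B (j i) ∧ φ b = 0} := by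
    intro i
    have hmaps : Set.MapsTo (fun b => b - φ b • (1 : A)) (B (j i))
        {b | b ∈ B (j i) ∧ φ b = 0} := fun b hb =>
      ⟨sub_mem hb (Subalgebra.smul_mem _ (one_mem _) _), by simp [h1]⟩
    have := map_mem_closure (f := fun b => b - φ b • (1 : A)) (by fun_prop)
      (show a i ∈ closure (B (j i) : Set A) from ha i) hmaps
    simpa [hφa i] using this
  have hclosed : IsClosed {a : Fin (n + 1) → A | φ (List.ofFn a).prod = 0} := by
    refine isClosed_eq (hφ.comp ?_) continuous_const
    simp only [List.ofFn_eq_map]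
    exact continuous_list_prod _ fun i _ => continuous_apply i
  have hmem : a ∈ closure (Set.univ.pi fun i => {b | b ∈ B (j i) ∧ φ b = 0}) := by
    rw [closure_pi_set]
    exact fun i _ => hcentred i
  refine closure_minimal (fun b hb => ?_) hclosed hmem
  exact h n j b (fun i => (hb i trivial).1) (fun i => (hb i trivial).2) hj

/-- An alternating product of centred elements of the algebras `B i`, beginning with a factor
from the algebra of the given index. It is the recursive form of the products in
`FreeSubalgebras`. -/
inductive IsAlternatingWord (φ : A →ₗ[ℂ] ℂ) (B : ι → Subalgebra ℂ A) : ι → A → Prop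
  | single {i : ι} {a : A} (ha : a ∈ B i) (h0 : φ a = 0) : IsAlternatingWord φ B i a
  | cons {i k : ι} {a w : A} (ha : a ∈ B i) (h0 : φ a = 0) (hik : i ≠ k)
      (hw : IsAlternatingWord φ B k w) : IsAlternatingWord φ B i (a * w)

theorem IsAlternatingWord.exists_fin {i : ι} {w : A} (hw : IsAlternatingWord φ B i w) :
    ∃ (n : ℕ) (j : Fin (n + 1) → ι) (a : Fin (n + 1) → A), j 0 = i ∧
      (∀ i, a i ∈ B (j i)) ∧ (∀ i, φ (a i) = 0) ∧
      (∀ i : Fin n, j i.castSucc ≠ j i.succ) ∧ (List.ofFn a).prod = w := by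
  induction hw with
  | @single i a ha h0 =>
    exact ⟨0, fun _ => i, fun _ => a, rfl, fun _ => ha, fun _ => h0, fun i => i.elim0, by simp⟩
  | @cons i k b w hb h0 hik _ ih =>
    obtain ⟨n, j, a, hj0, ha, hφa, hj, hprod⟩ := ih
    refine ⟨n + 1, Fin.cons i j, Fin.cons b a, rfl,
      Fin.cases (by simpa using hb) fun m => by simpa using ha m,
      Fin.cases (by simpa using h0) fun m => by simpa using hφa m,
      Fin.cases (by simpa [hj0] using hik) fun m => by simpa using hj m, ?_⟩
    simp only [List.ofFn_succ (n := n + 1), List.prod_cons, Fin.cons_zero, Fin.cons_succ]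
    rw [hprod]

theorem FreeSubalgebras.map_word (h : FreeSubalgebras φ B) {i : ι} {w : A}
    (hw : IsAlternatingWord φ B i w) : φ w = 0 := by
  obtain ⟨n, j, a, -, ha, h0, hj, rfl⟩ := hw.exists_fin
  exact h n j a ha h0 hj

theorem FreeSubalgebras.map_mul_word (h : FreeSubalgebras φ B) (h1 : φ 1 = 1) {i k : ι}
    (hik : i ≠ k) {x w : A} (hx : x ∈ B i) (hw : IsAlternatingWord φ B k w) : φ (x * w) = 0 := by
  have hcentred : φ ((x - φ x • (1 : A)) * w) = 0 :=
    h.map_word (.cons (sub_mem hx (Subalgebra.smul_mem _ (one_mem _) _)) (by simp [h1]) hik hw)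
  rw [sub_mul, map_sub, smul_mul_assoc, one_mul, map_smul, h.map_word hw] at hcentred
  simpa using hcentred

theorem IsAlternatingWord.mul_mul {i k : ι} (hik : i ≠ k) {P Q w : A} (hP : P ∈ B i)
    (hQ : Q ∈ B k) (hP0 : φ P = 0) (hQ0 : φ Q = 0) (hw : IsAlternatingWord φ B k w) :
    IsAlternatingWord φ B k (Q * P * w) :=
  mul_assoc Q P w ▸ .cons hQ hQ0 hik.symm (.cons hP hP0 hik hw)

theorem isAlternatingWord_pow_mul {i k : ι} (hik : i ≠ k) {P Q w : A} (hP : P ∈ B i)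
    (hQ : Q ∈ B k) (hP0 : φ P = 0) (hQ0 : φ Q = 0) (hw : IsAlternatingWord φ B k w) (n : ℕ) :
    IsAlternatingWord φ B k ((Q * P) ^ n * w) := by
  induction n with
  | zero => rwa [pow_zero, one_mul]
  | succ n ih =>
    rw [pow_succ', mul_assoc]
    exact ih.mul_mul hik hP hQ hP0 hQ0

end Words

section Subordination

theorem isUnit_and_inverse_inverse_add_inverse_sub_one {A : Type*}
    [NormedRing A] [CompleteSpace A] {a b : A} (ha : ‖a - 1‖ < 1) (hb : ‖b - 1‖ < 1) :
    IsUnit (a⁻¹ʳ + b⁻¹ʳ - 1) ∧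
      (a⁻¹ʳ + b⁻¹ʳ - 1)⁻¹ʳ = b * (1 - (a - 1) * (b - 1))⁻¹ʳ * a := by
  have hua : IsUnit a :=
    sub_sub_cancel 1 a ▸ isUnit_one_sub_of_norm_lt_one (norm_sub_rev a 1 ▸ ha)
  have hub : IsUnit b :=
    sub_sub_cancel 1 b ▸ isUnit_one_sub_of_norm_lt_one (norm_sub_rev b 1 ▸ hb)
  have hw : IsUnit (1 - (a - 1) * (b - 1)) := isUnit_one_sub_of_norm_lt_one <|
    (norm_mul_le _ _).trans_lt (mul_lt_one_of_nonneg_of_lt_one_left (norm_nonneg _) ha hb.le)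
  have hfactor : a⁻¹ʳ + b⁻¹ʳ - 1 = a⁻¹ʳ * (1 - (a - 1) * (b - 1)) * b⁻¹ʳ := by
    rw [show 1 - (a - 1) * (b - 1) = b + a - a * b by noncomm_ring, mul_sub, mul_add, sub_mul,
      add_mul, mul_assoc, Ring.mul_inverse_cancel _ hub, Ring.inverse_mul_cancel _ hua,
      Ring.inverse_mul_cancel_left _ _ hua, Ring.mul_inverse_cancel _ hub, mul_one, one_mul]
  rw [hfactor]
  refine ⟨(hua.ringInverse.mul hw).mul hub.ringInverse, ?_⟩
  rw [Ring.inverse_mul (.inr hub.ringInverse), Ring.inverse_mul (.inr hw),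
    Ring.inverse_inverse hua, Ring.inverse_inverse hub, mul_assoc]

variable {A : Type*} [NormedRing A] [NormedAlgebra ℂ A] [CompleteSpace A] {ι : Type*}
  {φ : A →ₗ[ℂ] ℂ} {B : ι → Subalgebra ℂ A}

theorem FreeSubalgebras.map_mul_inverse_one_sub_mul (h : FreeSubalgebras φ B)
    (hφ : Continuous φ) (h1 : φ 1 = 1) {i k : ι} (hik : i ≠ k) {P Q x : A} (hP : P ∈ B i)
    (hQ : Q ∈ B k) (hP0 : φ P = 0) (hQ0 : φ Q = 0) (hx : x ∈ B i) (hPQ : ‖P * Q‖ < 1) :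
    φ (x * ((1 + Q) * (1 - P * Q)⁻¹ʳ * (1 + P))) = φ (x * (1 + P)) := by
  have hword : ∀ y ∈ B i, ∀ n : ℕ, φ (y * ((Q * P) ^ n * (Q + Q * P))) = 0 := by
    intro y hy n
    have hQw : IsAlternatingWord φ B k Q := .single hQ hQ0
    have hQPw : IsAlternatingWord φ B k (Q * P) := .cons hQ hQ0 hik.symm (.single hP hP0)
    rw [mul_add, mul_add, map_add,
      h.map_mul_word h1 hik hy (isAlternatingWord_pow_mul hik hP hQ hP0 hQ0 hQw n),
      h.map_mul_word h1 hik hy (isAlternatingWord_pow_mul hik hP hQ hP0 hQ0 hQPw n), add_zero]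
  have hshift : ∀ n : ℕ, Q * (P * Q) ^ n * (1 + P) = (Q * P) ^ n * (Q + Q * P) := by
    intro n
    have hsemiconj : SemiconjBy Q (P * Q) (Q * P) := (mul_assoc Q P Q).symm
    rw [(hsemiconj.pow_right n).eq, mul_assoc, mul_add, mul_one]
  have hsum : HasSum (fun n : ℕ => φ (x * ((1 + Q) * (P * Q) ^ n * (1 + P))))
      (φ (x * ((1 + Q) * (1 - P * Q)⁻¹ʳ * (1 + P)))) :=
    ((((hasSum_geom_series_inverse (P * Q) hPQ).mul_left (1 + Q)).mul_right
      (1 + P)).mul_left x).map φ hφ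
  have hterm : ∀ n : ℕ, n ≠ 0 → φ (x * ((1 + Q) * (P * Q) ^ n * (1 + P))) = 0 := by
    intro n hn
    obtain ⟨m, rfl⟩ := Nat.exists_eq_succ_of_ne_zero hn
    have : x * ((1 + Q) * (P * Q) ^ (m + 1) * (1 + P)) =
        x * P * (Q * (P * Q) ^ m * (1 + P)) + x * (Q * (P * Q) ^ (m + 1) * (1 + P)) := by
      rw [add_mul, add_mul, one_mul, mul_add]
      simp only [pow_succ', mul_assoc]
    rw [Nat.succ_eq_add_one, this, map_add, hshift, hshift, hword _ (mul_mem hx hP),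
      hword _ hx, add_zero]
  have hzero := hword x hx 0
  rw [← hshift] at hzero
  rw [hsum.unique (hasSum_single 0 hterm), pow_zero, mul_one, add_mul, one_mul, mul_add, map_add]
  simpa using hzero

theorem FreeSubalgebras.map_mul_inverse (h : FreeSubalgebras φ B) (hφ : Continuous φ)
    (h1 : φ 1 = 1) {i k : ι} (hik : i ≠ k) {a b x : A} (ha : a ∈ B i) (hb : b ∈ B k)
    (hφa : φ a = 1) (hφb : φ b = 1) (hna : ‖a - 1‖ < 1) (hnb : ‖b - 1‖ < 1) (hx : x ∈ B i) :
    φ (x * (a⁻¹ʳ + b⁻¹ʳ - 1)⁻¹ʳ) = φ (x * a) := by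
  have hnorm : ‖(a - 1) * (b - 1)‖ < 1 := (norm_mul_le _ _).trans_lt
    (mul_lt_one_of_nonneg_of_lt_one_left (norm_nonneg _) hna hnb.le)
  have := h.map_mul_inverse_one_sub_mul hφ h1 hik (sub_mem ha (one_mem _))
    (sub_mem hb (one_mem _)) (by rw [map_sub, hφa, h1, sub_self])
    (by rw [map_sub, hφb, h1, sub_self]) hx hnorm
  rwa [add_sub_cancel, add_sub_cancel,
    ← (isUnit_and_inverse_inverse_add_inverse_sub_one hna hnb).2] at this

end Subordination

section Elemental

variable {A : Type*} [CStarAlgebra A]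

theorem inverse_mem_elemental {a b : A} (ha : IsSelfAdjoint a)
    (hb : b ∈ Algebra.elemental ℂ a) (hu : IsUnit b) : b⁻¹ʳ ∈ Algebra.elemental ℂ a := by
  have helemental : (StarAlgebra.elemental ℂ a).toSubalgebra = Algebra.elemental ℂ a := by
    change (StarAlgebra.adjoin ℂ {a}).toSubalgebra.topologicalClosure = _
    rw [StarAlgebra.adjoin_toSubalgebra, Set.star_singleton, ha.star_eq, Set.union_self]
    rfl
  rw [← helemental] at hb ⊢
  have : IsClosed (StarAlgebra.elemental ℂ a : Set A) := StarAlgebra.elemental.isClosed ℂ a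
  obtain ⟨v, hv⟩ := (StarSubalgebra.coe_isUnit (S := StarAlgebra.elemental ℂ a)
    (a := ⟨b, hb⟩)).1 hu
  have hinverse : b * (↑v⁻¹ : StarAlgebra.elemental ℂ a) = 1 := by
    simpa [hv] using congrArg Subtype.val v.mul_inv
  rw [show b⁻¹ʳ = (↑v⁻¹ : StarAlgebra.elemental ℂ a) by
    rw [← mul_one b⁻¹ʳ, Ring.inverse_mul_eq_iff_eq_mul _ _ _ hu, hinverse]]
  exact Subtype.property _

theorem algebraMap_sub_smul_mem_elemental (a : A) (r s : ℝ) :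
    algebraMap ℝ A r - s • a ∈ Algebra.elemental ℂ a := by
  rw [IsScalarTower.algebraMap_apply ℝ ℂ A, ← Complex.coe_smul]
  exact sub_mem (Subalgebra.algebraMap_mem _ _)
    (Subalgebra.smul_mem _ (Algebra.elemental.self_mem ℂ a) _)

end Elemental

section MomentGF

variable {A : Type*} [CStarAlgebra A] {φ : A →ₗ[ℂ] ℂ} {X : A}

/-- The moment generating function `u ↦ ∑ φ(Xⁿ) uⁿ = φ((1 - u X)⁻¹)` at real points; at `u ≠ 0`
it is `u⁻¹` times the Cauchy transform at `u⁻¹`. Junk where `1 - u X` is not invertible. -/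
def momentGF (φ : A →ₗ[ℂ] ℂ) (X : A) (u : ℝ) : ℝ := (φ (1 - u • X)⁻¹ʳ).re

theorem momentGF_zero (h1 : φ 1 = 1) : momentGF φ X 0 = 1 := by
  simp [momentGF, h1]

theorem analyticAt_inverse_one_sub_smul {u : ℝ} (hu : IsUnit (1 - u • X)) :
    AnalyticAt ℝ (fun t : ℝ => (1 - t • X)⁻¹ʳ) u := by
  obtain ⟨v, hv⟩ := hu
  refine AnalyticAt.fun_comp (hv ▸ analyticAt_inverse v) ?_
  exact analyticAt_const.sub (analyticAt_id.smul analyticAt_const)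

theorem analyticAt_momentGF (hφ : Continuous φ) {u : ℝ} (hu : IsUnit (1 - u • X)) :
    AnalyticAt ℝ (momentGF φ X) u := by
  let reφ : A →L[ℝ] ℝ := Complex.reCLM.comp (ContinuousLinearMap.restrictScalars ℝ ⟨φ, hφ⟩)
  exact (reφ.analyticAt _).fun_comp (analyticAt_inverse_one_sub_smul hu)

theorem hasFPowerSeriesAt_momentGF (hφ : Continuous φ) :
    HasFPowerSeriesAt (momentGF φ X)
      (FormalMultilinearSeries.ofScalars ℝ fun n => (φ (X ^ n)).re) 0 := by
  refine hasFPowerSeriesAt_iff.2 ?_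
  have hsmall : ∀ᶠ u : ℝ in 𝓝 0, ‖u • X‖ < 1 :=
    ContinuousAt.eventually_lt (by fun_prop) continuousAt_const (by simp)
  filter_upwards [hsmall] with u hu
  have hsum := (Complex.hasSum_iff _ _).1 ((hasSum_geom_series_inverse _ hu).map φ hφ)
  simpa [momentGF, smul_pow, φ.map_smul_of_tower, ← Complex.ofReal_pow,
    FormalMultilinearSeries.coeff_ofScalars] using hsum.1

theorem hasStrictDerivAt_momentGF_zero (hφ : Continuous φ) :
    HasStrictDerivAt (momentGF φ X) (φ X).re 0 := by
  simpa [FormalMultilinearSeries.ofScalars] using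
    (hasFPowerSeriesAt_momentGF (X := X) hφ).hasStrictDerivAt

theorem eventually_exists_mul_momentGF_eq (hφ : Continuous φ) (h1 : φ 1 = 1) (X Y : A)
    {p : ℝ → Prop} (hp : ∀ᶠ v in 𝓝 0, p v) :
    ∀ᶠ u in 𝓝 0, ∃ v, p v ∧ v * momentGF φ Y v = u * momentGF φ X u := by
  have hderiv : ∀ Z : A, HasStrictDerivAt (fun u => u * momentGF φ Z u) 1 0 := fun Z => by
    simpa [momentGF_zero h1] using
      (hasStrictDerivAt_id (0 : ℝ)).fun_mul (hasStrictDerivAt_momentGF_zero (X := Z) hφ)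
  have himage := image_mem_map (m := fun v => v * momentGF φ Y v) hp
  rw [(hderiv Y).map_nhds_eq one_ne_zero, zero_mul] at himage
  have htendsto := (hderiv X).hasDerivAt.continuousAt.tendsto
  rw [zero_mul] at htendsto
  exact htendsto himage

theorem eventually_add_mul_momentGF_ne_zero (hφ : Continuous φ) {r : ℝ} (hr : r ≠ 0) :
    ∀ᶠ u in 𝓝 0, r + u * momentGF φ X u ≠ 0 := by
  have hcont : ContinuousAt (fun u => r + u * momentGF φ X u) 0 := continuousAt_const.add
    (continuousAt_id.mul (hasStrictDerivAt_momentGF_zero hφ).hasDerivAt.continuousAt)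
  exact hcont.eventually_ne (by simpa using hr)

variable [PartialOrder A] [StarOrderedRing A]

theorem isStrictlyPositive_one_sub_smul (hX : 0 ≤ X) {u : ℝ} (hu : u * ‖X‖ < 1) :
    IsStrictlyPositive (1 - u • X) := by
  rcases le_total u 0 with hu0 | hu0
  · rw [sub_eq_add_neg, ← neg_smul]
    exact isStrictlyPositive_one.add_nonneg (smul_nonneg (neg_nonneg.2 hu0) hX)
  · refine (isStrictlyPositive_algebraMap (A := A) (sub_pos.2 hu)).of_le ?_
    rw [map_sub, map_one, map_mul, ← Algebra.smul_def]
    exact sub_le_sub_left (smul_le_smul_of_nonneg_left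
      hX.isSelfAdjoint.le_algebraMap_norm_self hu0) _

theorem IsState.map_inverse_one_sub_smul (hφ : IsState φ) (hX : IsSelfAdjoint X) (u : ℝ) :
    φ (1 - u • X)⁻¹ʳ = momentGF φ X u := by
  refine hφ.eq_re_of_isSelfAdjoint ?_
  have h : IsSelfAdjoint (1 - u • X) := (IsSelfAdjoint.one A).sub ((IsSelfAdjoint.all u).smul hX)
  rw [IsSelfAdjoint, ← Ring.inverse_star, h.star_eq]

theorem momentGF_pos (hφ : IsState φ) (hX : 0 ≤ X) {u : ℝ} (hu : u * ‖X‖ < 1) :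
    0 < momentGF φ X u :=
  hφ.re_pos (isStrictlyPositive_one_sub_smul hX hu).ringInverse

theorem momentGF_le_one (hφ : IsState φ) (hX : 0 ≤ X) {u : ℝ} (hu : u ≤ 0) :
    momentGF φ X u ≤ 1 := by
  have hle : (1 : A) ≤ 1 - u • X := by
    rw [sub_eq_add_neg, ← neg_smul]
    exact le_add_of_nonneg_right (smul_nonneg (neg_nonneg.2 hu) hX)
  have := hφ.re_mono (CStarAlgebra.ringInverse_le_ringInverse hle)
  simpa [momentGF, hφ.map_one] using this

theorem analyticOnNhd_momentGF (hφ : IsState φ) (hX : 0 ≤ X) :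
    AnalyticOnNhd ℝ (momentGF φ X) {u | u * ‖X‖ < 1} := fun _ hu =>
  analyticAt_momentGF hφ.continuous (isStrictlyPositive_one_sub_smul hX hu).isUnit

end MomentGF

section Distribution

variable {A : Type*} [CStarAlgebra A] [PartialOrder A] [StarOrderedRing A] {φ : A →ₗ[ℂ] ℂ}
  {X : A}

theorem hasFPowerSeriesAt_integral_inv_one_sub_mul {μ : Measure ℝ} [IsFiniteMeasure μ]
    {K : Set ℝ} (hK : IsCompact K) (hμK : μ Kᶜ = 0) :
    HasFPowerSeriesAt (fun u => ∫ t, (1 - u * t)⁻¹ ∂μ)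
      (FormalMultilinearSeries.ofScalars ℝ fun n => ∫ t, t ^ n ∂μ) 0 := by
  obtain ⟨C, hC⟩ := hK.isBounded.exists_norm_le
  have hbound : ∀ᵐ t ∂μ, ‖t‖ ≤ C := Filter.mem_of_superset (mem_ae_iff.2 hμK) hC
  have hsmall : ∀ᶠ u : ℝ in 𝓝 0, ‖u‖ * C < 1 :=
    ContinuousAt.eventually_lt (by fun_prop) continuousAt_const (by simp)
  refine hasFPowerSeriesAt_iff.2 (hsmall.mono fun u hu => ?_)
  have hterm : ∀ n, ∀ᵐ t ∂μ, ‖(u * t) ^ n‖ ≤ (‖u‖ * C) ^ n := fun n => by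
    filter_upwards [hbound] with t ht
    rw [norm_pow, norm_mul]
    gcongr
  have hC0 : ∀ᵐ _ ∂μ, 0 ≤ ‖u‖ * C := by
    filter_upwards [hbound] with t ht
    exact mul_nonneg (norm_nonneg u) ((norm_nonneg t).trans ht)
  have hsum := hasSum_integral_of_dominated_convergence (fun n _ => (‖u‖ * C) ^ n)
    (F := fun n t => (u * t) ^ n) (f := fun t => (1 - u * t)⁻¹) (μ := μ)
    (fun n => by fun_prop) hterm
    (hC0.mono fun _ ht => summable_geometric_of_lt_one ht hu) (integrable_const _) ?_
  · simpa [mul_pow, integral_const_mul, FormalMultilinearSeries.coeff_ofScalars] using hsum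
  · filter_upwards [hterm 1] with t ht
    exact hasSum_geometric_of_norm_lt_one ((by simpa using ht : ‖u * t‖ ≤ ‖u‖ * C).trans_lt hu)

theorem IsState.hasDistribution_of_momentGF_eq (hφ : IsState φ) (hX : IsSelfAdjoint X)
    {μ : Measure ℝ} [IsFiniteMeasure μ] {K : Set ℝ} (hK : IsCompact K) (hμK : μ Kᶜ = 0)
    (h : ∀ᶠ u in 𝓝 0, momentGF φ X u = ∫ t, (1 - u * t)⁻¹ ∂μ) : HasDistribution φ X μ := by
  have hseries := (hasFPowerSeriesAt_momentGF (X := X) hφ.continuous).eq_formalMultilinearSeries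
    ((hasFPowerSeriesAt_integral_inv_one_sub_mul hK hμK).congr (h.mono fun _ hu => hu.symm))
  have hmoments : ∀ n : ℕ, (φ (X ^ n)).re = ∫ t, t ^ n ∂μ := fun n => by
    simpa [FormalMultilinearSeries.coeff_ofScalars] using congrArg (·.coeff n) hseries
  refine ⟨⟨?_⟩, ⟨K, hK, hμK⟩, fun n => ?_⟩
  · have hmass : 1 = μ.real Set.univ := by simpa [hφ.map_one] using hmoments 0
    exact (ENNReal.toReal_eq_one_iff _).1 hmass.symm
  · rw [hφ.eq_re_of_isSelfAdjoint (hX.pow n), hmoments]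

end Distribution

section NormalizedResolvent

variable {A : Type*} [CStarAlgebra A] {φ : A →ₗ[ℂ] ℂ} {X : A} {u : ℝ}

/-- The resolvent `(1 - u X)⁻¹` divided by its expectation. -/
def normalizedResolvent (φ : A →ₗ[ℂ] ℂ) (X : A) (u : ℝ) : A :=
  (momentGF φ X u)⁻¹ • (1 - u • X)⁻¹ʳ

theorem eventually_norm_normalizedResolvent_sub_one_lt (hφ : Continuous φ) (h1 : φ 1 = 1)
    (X : A) : ∀ᶠ u in 𝓝 0, ‖normalizedResolvent φ X u - 1‖ < 1 := by
  have hunit : IsUnit (1 - (0 : ℝ) • X) := by simp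
  have hcont : ContinuousAt (normalizedResolvent φ X) 0 :=
    ((analyticAt_momentGF hφ hunit).continuousAt.inv₀ (by simp [momentGF_zero h1])).smul
      (analyticAt_inverse_one_sub_smul hunit).continuousAt
  refine ContinuousAt.eventually_lt (hcont.sub continuousAt_const).norm continuousAt_const ?_
  simp [normalizedResolvent, momentGF_zero h1]

theorem isUnit_normalizedResolvent (h : ‖normalizedResolvent φ X u - 1‖ < 1) :
    IsUnit (normalizedResolvent φ X u) :=
  sub_sub_cancel 1 (normalizedResolvent φ X u) ▸
    isUnit_one_sub_of_norm_lt_one (norm_sub_rev (normalizedResolvent φ X u) 1 ▸ h)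

theorem momentGF_ne_zero [Nontrivial A] (h : ‖normalizedResolvent φ X u - 1‖ < 1) :
    momentGF φ X u ≠ 0 := fun h0 =>
  (isUnit_normalizedResolvent h).ne_zero (by rw [normalizedResolvent, h0, inv_zero, zero_smul])

theorem isUnit_one_sub_smul [Nontrivial A] (h : ‖normalizedResolvent φ X u - 1‖ < 1) :
    IsUnit (1 - u • X) := by
  have hunit := (isUnit_normalizedResolvent h).smul (Units.mk0 _ (momentGF_ne_zero h))
  rw [normalizedResolvent, Units.smul_def, Units.val_mk0, smul_inv_smul₀ (momentGF_ne_zero h)]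
    at hunit
  exact isUnit_ringInverse.1 hunit

theorem inverse_normalizedResolvent [Nontrivial A] (h : ‖normalizedResolvent φ X u - 1‖ < 1) :
    (normalizedResolvent φ X u)⁻¹ʳ = momentGF φ X u • (1 - u • X) := by
  rw [← mul_one (normalizedResolvent φ X u)⁻¹ʳ,
    Ring.inverse_mul_eq_iff_eq_mul _ _ _ (isUnit_normalizedResolvent h), normalizedResolvent,
    smul_mul_smul_comm, inv_mul_cancel₀ (momentGF_ne_zero h), one_smul,
    Ring.inverse_mul_cancel _ (isUnit_one_sub_smul h)]

theorem momentGF_smul_inverse_mul_normalizedResolvent [Nontrivial A]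
    (h : ‖normalizedResolvent φ X u - 1‖ < 1) (hX : IsUnit X) :
    momentGF φ X u • (X⁻¹ʳ * normalizedResolvent φ X u) =
      X⁻¹ʳ + (u * momentGF φ X u) • normalizedResolvent φ X u := by
  have hresolvent : X⁻¹ʳ * (1 - u • X)⁻¹ʳ = X⁻¹ʳ + u • (1 - u • X)⁻¹ʳ := by
    rw [Ring.inverse_mul_eq_iff_eq_mul _ _ _ hX, mul_add, Ring.mul_inverse_cancel _ hX,
      mul_smul_comm, ← smul_mul_assoc, ← sub_eq_iff_eq_add, ← one_sub_mul,
      Ring.mul_inverse_cancel _ (isUnit_one_sub_smul h)]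
  rw [normalizedResolvent, mul_smul_comm, smul_inv_smul₀ (momentGF_ne_zero h), hresolvent,
    smul_smul, mul_assoc, mul_inv_cancel₀ (momentGF_ne_zero h), mul_one]

theorem normalizedResolvent_mem_elemental [Nontrivial A] (hX : IsSelfAdjoint X)
    (h : ‖normalizedResolvent φ X u - 1‖ < 1) :
    normalizedResolvent φ X u ∈ Algebra.elemental ℂ X := by
  have hmem := algebraMap_sub_smul_mem_elemental X 1 u
  rw [map_one] at hmem
  rw [normalizedResolvent, ← Complex.coe_smul]
  exact Subalgebra.smul_mem _ (inverse_mem_elemental hX hmem (isUnit_one_sub_smul h)) _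

theorem inverse_normalizedResolvent_add_sub_one [Nontrivial A] {Y : A} {v : ℝ}
    (hu : ‖normalizedResolvent φ X u - 1‖ < 1) (hv : ‖normalizedResolvent φ Y v - 1‖ < 1)
    (huv : u * momentGF φ X u = v * momentGF φ Y v) :
    (normalizedResolvent φ X u)⁻¹ʳ + (normalizedResolvent φ Y v)⁻¹ʳ - 1 =
      algebraMap ℝ A (momentGF φ X u + momentGF φ Y v - 1) -
        (u * momentGF φ X u) • (X + Y) := by
  rw [inverse_normalizedResolvent hu, inverse_normalizedResolvent hv, smul_add]
  nth_rw 2 [huv]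
  rw [Algebra.algebraMap_eq_smul_one]
  module

theorem IsState.map_normalizedResolvent [PartialOrder A] [StarOrderedRing A] [Nontrivial A]
    (hφ : IsState φ) (hX : IsSelfAdjoint X) (h : ‖normalizedResolvent φ X u - 1‖ < 1) :
    φ (normalizedResolvent φ X u) = 1 := by
  rw [normalizedResolvent, φ.map_smul_of_tower, hφ.map_inverse_one_sub_smul hX,
    Complex.real_smul, ← Complex.ofReal_mul, inv_mul_cancel₀ (momentGF_ne_zero h),
    Complex.ofReal_one]

end NormalizedResolvent

section FreePair

variable {A : Type*} [CStarAlgebra A] [PartialOrder A] [StarOrderedRing A] {φ : A →ₗ[ℂ] ℂ}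
  {X Y : A} {u v : ℝ}

theorem Free.map_mul_inverse_of_mul_momentGF_eq (hfree : Free φ X Y) (hφ : IsState φ)
    (hX : IsSelfAdjoint X) (hY : IsSelfAdjoint Y)
    (hu : ‖normalizedResolvent φ X u - 1‖ < 1) (hv : ‖normalizedResolvent φ Y v - 1‖ < 1)
    (huv : u * momentGF φ X u = v * momentGF φ Y v) {T : A}
    (hT : T = algebraMap ℝ A (momentGF φ X u + momentGF φ Y v - 1) -
      (u * momentGF φ X u) • (X + Y)) :
    IsUnit T ∧
      (∀ h ∈ Algebra.elemental ℂ X, φ (h * T⁻¹ʳ) = φ (h * normalizedResolvent φ X u)) ∧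
      ∀ h ∈ Algebra.elemental ℂ Y, φ (h * T⁻¹ʳ) = φ (h * normalizedResolvent φ Y v) := by
  have := hφ.nontrivial
  rw [← inverse_normalizedResolvent_add_sub_one hu hv huv] at hT
  have hclosure := FreeSubalgebras.topologicalClosure hfree hφ.continuous hφ.map_one
  have hmemX := normalizedResolvent_mem_elemental hX hu
  have hmemY := normalizedResolvent_mem_elemental hY hv
  have hmapX := hφ.map_normalizedResolvent hX hu
  have hmapY := hφ.map_normalizedResolvent hY hv
  rw [hT]
  refine ⟨(isUnit_and_inverse_inverse_add_inverse_sub_one hu hv).1, fun h hh => ?_,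
    fun h hh => ?_⟩
  · exact hclosure.map_mul_inverse (i := 0) (k := 1) hφ.continuous hφ.map_one (by decide) hmemX
      hmemY hmapX hmapY hu hv hh
  · rw [add_comm (normalizedResolvent φ X u)⁻¹ʳ]
    exact hclosure.map_mul_inverse (i := 1) (k := 0) hφ.continuous hφ.map_one (by decide) hmemY
      hmemX hmapY hmapX hv hu hh

end FreePair

section Regression

variable {A : Type*} [CStarAlgebra A] {φ : A →ₗ[ℂ] ℂ} {X Y : A} {c d : ℝ}

/-- The conditional expectation of `V` given `S` is the constant `c`, expressed by testing
against the norm closed algebra generated by `S`. -/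
def HasConstantRegression (φ : A →ₗ[ℂ] ℂ) (V S : A) (c : ℝ) : Prop :=
  ∀ T ∈ Algebra.elemental ℂ S, φ (V * T) = c * φ T

theorem HasConstantRegression.re_map_inverse_left_mul
    (hc : HasConstantRegression φ (X⁻¹ʳ - (X + Y)⁻¹ʳ) (X + Y) c) {T : A}
    (hT : T ∈ Algebra.elemental ℂ (X + Y)) :
    (φ (X⁻¹ʳ * T)).re = c * (φ T).re + (φ ((X + Y)⁻¹ʳ * T)).re := by
  have h := hc T hT
  rw [sub_mul, map_sub, sub_eq_iff_eq_add] at h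
  rw [h, Complex.add_re, Complex.re_ofReal_mul]

theorem inverse_inverse_sub_inverse_add (hX : IsUnit X) (hY : IsUnit Y) (hXY : IsUnit (X + Y)) :
    (X⁻¹ʳ - (X + Y)⁻¹ʳ)⁻¹ʳ = X * Y⁻¹ʳ * (X + Y) := by
  have hfactor : X⁻¹ʳ - (X + Y)⁻¹ʳ = (X + Y)⁻¹ʳ * Y * X⁻¹ʳ := by
    rw [eq_comm, ← Ring.eq_mul_inverse_iff_mul_eq _ _ _ hX.ringInverse, Ring.inverse_inverse hX,
      eq_comm, sub_mul, Ring.inverse_mul_cancel _ hX, sub_eq_iff_eq_add', ← mul_add,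
      Ring.inverse_mul_cancel _ hXY]
  rw [hfactor, Ring.inverse_mul (.inr hX.ringInverse), Ring.inverse_mul (.inr hY),
    Ring.inverse_inverse hX, Ring.inverse_inverse hXY, mul_assoc]

theorem commute_of_mem_elemental {S T : A} (hT : T ∈ Algebra.elemental ℂ S) : Commute S T :=
  Subalgebra.mem_centralizer_iff ℂ |>.1 (Algebra.elemental.le_centralizer_centralizer ℂ S hT) S
    (Subalgebra.mem_centralizer_iff ℂ |>.2 fun s hs => by rw [Set.mem_singleton_iff.1 hs])

theorem HasConstantRegression.re_map_inverse_right_mul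
    (hd : HasConstantRegression φ (X⁻¹ʳ - (X + Y)⁻¹ʳ)⁻¹ʳ (X + Y) d)
    (htr : ∀ a b, φ (a * b) = φ (b * a)) (hX : IsUnit X) (hY : IsUnit Y)
    (hS : IsUnit (X + Y)) (hSsa : IsSelfAdjoint (X + Y)) {T : A}
    (hT : T ∈ Algebra.elemental ℂ (X + Y)) :
    (φ (Y⁻¹ʳ * T)).re = (φ ((X + Y)⁻¹ʳ * T)).re +
      d * (φ ((X + Y)⁻¹ʳ * ((X + Y)⁻¹ʳ * T))).re := by
  have hSmem : (X + Y)⁻¹ʳ ∈ Algebra.elemental ℂ (X + Y) :=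
    inverse_mem_elemental hSsa (Algebra.elemental.self_mem ℂ _) hS
  have hmul : (X⁻¹ʳ - (X + Y)⁻¹ʳ)⁻¹ʳ * ((X + Y)⁻¹ʳ * ((X + Y)⁻¹ʳ * T)) =
      (X + Y) * (Y⁻¹ʳ * ((X + Y)⁻¹ʳ * T)) - (X + Y)⁻¹ʳ * T := by
    rw [inverse_inverse_sub_inverse_add hX hY hS, mul_assoc, Ring.mul_inverse_cancel_left _ _ hS,
      add_mul, Ring.mul_inverse_cancel_left _ _ hY, mul_assoc, add_sub_cancel_right]
  have hcyclic : Y⁻¹ʳ * ((X + Y)⁻¹ʳ * T) * (X + Y) = Y⁻¹ʳ * T := by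
    rw [mul_assoc, mul_assoc, ← (commute_of_mem_elemental hT).eq,
      Ring.inverse_mul_cancel_left _ _ hS]
  have h := hd _ (mul_mem hSmem (mul_mem hSmem hT))
  rw [hmul, map_sub, htr (X + Y), hcyclic, sub_eq_iff_eq_add'] at h
  rw [h, Complex.add_re, Complex.re_ofReal_mul]

theorem HasConstantRegression.pos [PartialOrder A] [StarOrderedRing A]
    (hd : HasConstantRegression φ (X⁻¹ʳ - (X + Y)⁻¹ʳ)⁻¹ʳ (X + Y) d) (hφ : IsState φ)
    (hX : IsStrictlyPositive X) (hY : IsStrictlyPositive Y) : 0 < d := by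
  have hinverse : (X⁻¹ʳ - (X + Y)⁻¹ʳ)⁻¹ʳ = star X * Y⁻¹ʳ * X + X := by
    rw [inverse_inverse_sub_inverse_add hX.isUnit hY.isUnit (hX.add_nonneg hY.nonneg).isUnit,
      mul_add, Ring.inverse_mul_cancel_right _ _ hY.isUnit, hX.isSelfAdjoint.star_eq]
  have h := hd 1 (one_mem _)
  rw [mul_one, hφ.map_one, mul_one, hinverse] at h
  have hpos := hφ.re_pos (IsStrictlyPositive.nonneg_add
    (star_left_conjugate_nonneg hY.ringInverse.nonneg X) hX)
  rwa [h, Complex.ofReal_re] at hpos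

end Regression

section MatsumotoYor

theorem cancel_regression_relations {p q g k k₂ σ σ₂ c d δ : ℝ}
    (hk : (p + q - 1) * k = σ + g) (hk₂ : (p + q - 1) * k₂ = σ₂ + g * k)
    (hp : p * (c + k) = c + σ + g) (hq : q * (k + d * k₂) = δ + g) (hδ : δ = σ + d * σ₂)
    (hσg : σ + g ≠ 0) (hδg : δ + g ≠ 0) :
    q * (δ - (c * d - 1) * g) = δ + g ∧
      (p - 1) * (p * (δ - (c * d - 1) * g) + c * d * g) = d * g * (σ + g) := by
  have hleft : c * ((p + q - 1) * (p - 1)) = (σ + g) * (q - 1) := by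
    linear_combination (p + q - 1) * hp - p * hk
  have hmid : d * g * k * q = (δ + g) * (p - 1) := by
    linear_combination (p + q - 1) * hq - q * hk - q * d * hk₂ + q * hδ
  have hright : d * g * (σ + g) * q = (δ + g) * ((p + q - 1) * (p - 1)) := by
    linear_combination (p + q - 1) * hmid - d * g * q * hk
  have hY : q * (δ - (c * d - 1) * g) = δ + g := by
    refine mul_left_cancel₀ hσg ?_
    linear_combination (-c) * hright - (δ + g) * hleft
  have hq0 : q ≠ 0 := fun h => hδg (by rw [← hY, h, zero_mul])
  refine ⟨hY, mul_left_cancel₀ hq0 ?_⟩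
  linear_combination ((p + q - 1) * (p - 1) - q * (p - 1)) * hY - hright

variable {A : Type*} [CStarAlgebra A]

theorem smul_inverse_mul_inverse_algebraMap_sub_smul {S : A} {w g : ℝ} (hS : IsUnit S)
    (hT : IsUnit (algebraMap ℝ A w - g • S)) :
    w • (S⁻¹ʳ * (algebraMap ℝ A w - g • S)⁻¹ʳ) =
      S⁻¹ʳ + g • (algebraMap ℝ A w - g • S)⁻¹ʳ := by
  have hsplit : S⁻¹ʳ * (algebraMap ℝ A w - g • S) = w • S⁻¹ʳ - g • 1 := by
    rw [mul_sub, mul_smul_comm, Ring.inverse_mul_cancel _ hS, ← Algebra.commutes,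
      ← Algebra.smul_def]
  have h := congrArg (· * (algebraMap ℝ A w - g • S)⁻¹ʳ) hsplit
  simp only [Ring.mul_inverse_cancel_right _ _ hT, sub_mul, smul_mul_assoc, one_mul] at h
  exact sub_eq_iff_eq_add.1 h.symm

variable [PartialOrder A] {φ : A →ₗ[ℂ] ℂ} {X Y : A} {c d u v : ℝ}

section

variable [StarOrderedRing A]

theorem Free.exists_resolvent (hfree : Free φ X Y) (hφ : IsState φ)
    (hX : IsStrictlyPositive X) (hY : IsStrictlyPositive Y)
    (hu : ‖normalizedResolvent φ X u - 1‖ < 1) (hv : ‖normalizedResolvent φ Y v - 1‖ < 1)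
    {g : ℝ} (hgu : g = u * momentGF φ X u) (hgv : g = v * momentGF φ Y v) :
    ∃ R ∈ Algebra.elemental ℂ (X + Y), φ R = 1 ∧
      (momentGF φ X u + momentGF φ Y v - 1) • ((X + Y)⁻¹ʳ * R) = (X + Y)⁻¹ʳ + g • R ∧
      momentGF φ X u * (φ (X⁻¹ʳ * R)).re = (φ X⁻¹ʳ).re + g ∧
      momentGF φ Y v * (φ (Y⁻¹ʳ * R)).re = (φ Y⁻¹ʳ).re + g := by
  have := hφ.nontrivial
  have hS : IsStrictlyPositive (X + Y) := hX.add_nonneg hY.nonneg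
  obtain ⟨hT, hmapX, hmapY⟩ := hfree.map_mul_inverse_of_mul_momentGF_eq hφ hX.isSelfAdjoint
    hY.isSelfAdjoint hu hv (hgu ▸ hgv) rfl
  rw [← hgu] at hT hmapX hmapY
  have hpairing : ∀ {Z : A} {t : ℝ}, IsStrictlyPositive Z →
      ‖normalizedResolvent φ Z t - 1‖ < 1 → g = t * momentGF φ Z t →
      momentGF φ Z t * (φ (Z⁻¹ʳ * normalizedResolvent φ Z t)).re = (φ Z⁻¹ʳ).re + g := by
    intro Z t hZ ht hg
    simpa [φ.map_smul_of_tower, hφ.map_normalizedResolvent hZ.isSelfAdjoint ht, ← hg] using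
      congrArg (fun a => (φ a).re) (momentGF_smul_inverse_mul_normalizedResolvent ht hZ.isUnit)
  have hinverse : ∀ {Z : A}, IsStrictlyPositive Z → Z⁻¹ʳ ∈ Algebra.elemental ℂ Z := fun hZ =>
    inverse_mem_elemental hZ.isSelfAdjoint (Algebra.elemental.self_mem ℂ _) hZ.isUnit
  refine ⟨_, inverse_mem_elemental hS.isSelfAdjoint (algebraMap_sub_smul_mem_elemental _ _ _) hT,
    ?_, smul_inverse_mul_inverse_algebraMap_sub_smul hS.isUnit hT, ?_, ?_⟩
  · simpa [hφ.map_normalizedResolvent hX.isSelfAdjoint hu] using hmapX 1 (one_mem _)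
  · rw [hmapX _ (hinverse hX), hpairing hX hu hgu]
  · rw [hmapY _ (hinverse hY), hpairing hY hv hgv]

end

/-- A quadratic equation for the value `m` at `u` of a moment generating function; it covers both
the free Poisson law (`β = k = 0`) and the free generalized inverse Gaussian law. -/
def gigQuadratic (α l β k u m : ℝ) : ℝ :=
  u * m ^ 2 - (α + l * u - β * u ^ 2) * m + (α + k * u)

/-- Free positive invertible variables `X`, `Y` with the Matsumoto–Yor regression property:
`V = X⁻¹ - (X + Y)⁻¹` and `V⁻¹` have constant conditional expectations `c` and `d` given
`X + Y`. -/
structure IsMatsumotoYorPair (φ : A →ₗ[ℂ] ℂ) (X Y : A) (c d : ℝ) : Prop where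
  isState : IsState φ
  tracial : ∀ a b, φ (a * b) = φ (b * a)
  left_pos : IsStrictlyPositive X
  right_pos : IsStrictlyPositive Y
  free : Free φ X Y
  regression : HasConstantRegression φ (X⁻¹ʳ - (X + Y)⁻¹ʳ) (X + Y) c
  inverse_regression : HasConstantRegression φ (X⁻¹ʳ - (X + Y)⁻¹ʳ)⁻¹ʳ (X + Y) d

namespace IsMatsumotoYorPair

theorem re_map_left_inverse (h : IsMatsumotoYorPair φ X Y c d) :
    (φ X⁻¹ʳ).re = c + (φ (X + Y)⁻¹ʳ).re := by
  simpa [h.isState.map_one] using h.regression.re_map_inverse_left_mul (one_mem _)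

variable [StarOrderedRing A]

theorem re_map_right_inverse (h : IsMatsumotoYorPair φ X Y c d) :
    (φ Y⁻¹ʳ).re = (φ (X + Y)⁻¹ʳ).re + d * (φ ((X + Y)⁻¹ʳ * (X + Y)⁻¹ʳ)).re := by
  have hS : IsStrictlyPositive (X + Y) := h.left_pos.add_nonneg h.right_pos.nonneg
  simpa using h.inverse_regression.re_map_inverse_right_mul h.tracial h.left_pos.isUnit
    h.right_pos.isUnit hS.isUnit hS.isSelfAdjoint (one_mem _)

theorem re_map_inverse_add_pos (h : IsMatsumotoYorPair φ X Y c d) :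
    0 < (φ (X + Y)⁻¹ʳ).re :=
  h.isState.re_pos (h.left_pos.add_nonneg h.right_pos.nonneg).ringInverse

theorem momentGF_relations (h : IsMatsumotoYorPair φ X Y c d)
    (hu : ‖normalizedResolvent φ X u - 1‖ < 1) (hv : ‖normalizedResolvent φ Y v - 1‖ < 1)
    {g : ℝ} (hgu : g = u * momentGF φ X u) (hgv : g = v * momentGF φ Y v)
    (hσg : (φ (X + Y)⁻¹ʳ).re + g ≠ 0) (hδg : (φ Y⁻¹ʳ).re + g ≠ 0) :
    momentGF φ Y v * ((φ Y⁻¹ʳ).re - (c * d - 1) * g) = (φ Y⁻¹ʳ).re + g ∧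
      (momentGF φ X u - 1) *
          (momentGF φ X u * ((φ Y⁻¹ʳ).re - (c * d - 1) * g) + c * d * g) =
        d * g * ((φ (X + Y)⁻¹ʳ).re + g) := by
  have hX := h.left_pos
  have hY := h.right_pos
  have hS : IsStrictlyPositive (X + Y) := hX.add_nonneg hY.nonneg
  obtain ⟨R, hRmem, hmapR, hSR, hXR, hYR⟩ :=
    h.free.exists_resolvent h.isState hX hY hu hv hgu hgv
  have hk : (momentGF φ X u + momentGF φ Y v - 1) * (φ ((X + Y)⁻¹ʳ * R)).re =
      (φ (X + Y)⁻¹ʳ).re + g := by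
    simpa [φ.map_smul_of_tower, hmapR] using congrArg (fun a => (φ a).re) hSR
  have hk₂ : (momentGF φ X u + momentGF φ Y v - 1) *
      (φ ((X + Y)⁻¹ʳ * ((X + Y)⁻¹ʳ * R))).re =
        (φ ((X + Y)⁻¹ʳ * (X + Y)⁻¹ʳ)).re + g * (φ ((X + Y)⁻¹ʳ * R)).re := by
    simpa [φ.map_smul_of_tower, mul_add, mul_smul_comm] using
      congrArg (fun a => (φ ((X + Y)⁻¹ʳ * a)).re) hSR
  refine cancel_regression_relations hk hk₂ ?_ ?_ h.re_map_right_inverse hσg hδg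
  · rw [← h.re_map_left_inverse, ← hXR, h.regression.re_map_inverse_left_mul hRmem, hmapR,
      Complex.one_re, mul_one]
  · rw [← hYR, h.inverse_regression.re_map_inverse_right_mul h.tracial hX.isUnit hY.isUnit
      hS.isUnit hS.isSelfAdjoint hRmem]

theorem eventually_momentGF_right (h : IsMatsumotoYorPair φ X Y c d) :
    ∀ᶠ v in 𝓝 0, momentGF φ Y v * ((φ Y⁻¹ʳ).re - (c * d - 1) * (v * momentGF φ Y v)) =
      (φ Y⁻¹ʳ).re + v * momentGF φ Y v := by
  have hφ := h.isState
  filter_upwards [eventually_exists_mul_momentGF_eq hφ.continuous hφ.map_one Y X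
      (eventually_norm_normalizedResolvent_sub_one_lt hφ.continuous hφ.map_one X),
    eventually_norm_normalizedResolvent_sub_one_lt hφ.continuous hφ.map_one Y,
    eventually_add_mul_momentGF_ne_zero hφ.continuous (X := Y) h.re_map_inverse_add_pos.ne',
    eventually_add_mul_momentGF_ne_zero hφ.continuous (X := Y)
      (hφ.re_pos h.right_pos.ringInverse).ne'] with v ⟨u, hu, huv⟩ hv hσ hδ
  exact (h.momentGF_relations hu hv huv.symm rfl hσ hδ).1

theorem eventually_gigQuadratic_right (h : IsMatsumotoYorPair φ X Y c d) (hcd : c * d - 1 ≠ 0) :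
    ∀ᶠ v in 𝓝 0, gigQuadratic ((φ Y⁻¹ʳ).re / (c * d - 1)) (1 - c * d / (c * d - 1)) 0 0 v
      (momentGF φ Y v) = 0 := by
  filter_upwards [h.eventually_momentGF_right] with v hv
  rw [gigQuadratic]
  field_simp
  linear_combination -hv

theorem eventually_gigQuadratic_left (h : IsMatsumotoYorPair φ X Y c d) (hcd : c * d - 1 ≠ 0) :
    ∀ᶠ u in 𝓝 0, gigQuadratic ((φ Y⁻¹ʳ).re / (c * d - 1)) (1 + c * d / (c * d - 1))
      (d / (c * d - 1)) (d / (c * d - 1) * (φ X⁻¹ʳ).re) u (momentGF φ X u) = 0 := by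
  have hφ := h.isState
  have := hφ.nontrivial
  filter_upwards [eventually_exists_mul_momentGF_eq hφ.continuous hφ.map_one X Y
      (eventually_norm_normalizedResolvent_sub_one_lt hφ.continuous hφ.map_one Y),
    eventually_norm_normalizedResolvent_sub_one_lt hφ.continuous hφ.map_one X,
    eventually_add_mul_momentGF_ne_zero hφ.continuous (X := X) h.re_map_inverse_add_pos.ne',
    eventually_add_mul_momentGF_ne_zero hφ.continuous (X := X)
      (hφ.re_pos h.right_pos.ringInverse).ne'] with u ⟨v, hv, huv⟩ hu hσ hδ
  have hrelation := (h.momentGF_relations hu hv rfl huv.symm hσ hδ).2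
  rw [gigQuadratic, h.re_map_left_inverse]
  refine mul_left_cancel₀ (momentGF_ne_zero hu) ?_
  field_simp
  linear_combination -hrelation

theorem re_map_inverse_mul_re_map (h : IsMatsumotoYorPair φ X Y c d) :
    (φ Y⁻¹ʳ).re * (φ Y).re = c * d := by
  have hφ := h.isState
  have hderiv := (hasStrictDerivAt_momentGF_zero (X := Y) hφ.continuous).hasDerivAt
  have hmul := (hasDerivAt_id' (0 : ℝ)).fun_mul hderiv
  have hleft := hderiv.fun_mul (((hmul.const_mul (c * d - 1))).const_sub (φ Y⁻¹ʳ).re)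
  have hright := hmul.const_add (φ Y⁻¹ʳ).re
  have heq := hleft.unique (hright.congr_of_eventuallyEq h.eventually_momentGF_right)
  simp only [momentGF_zero hφ.map_one] at heq
  linarith

theorem one_lt_mul (h : IsMatsumotoYorPair φ X Y c d) (hY : NonDegenerate φ Y) : 1 < c * d := by
  have hφ := h.isState
  have hδ := hφ.re_pos h.right_pos.ringInverse
  refine lt_of_le_of_ne ?_ fun hcd => hY (φ Y⁻¹ʳ).re⁻¹ ?_
  · rw [← h.re_map_inverse_mul_re_map, mul_comm]
    exact hφ.one_le_mul_inverse h.right_pos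
  · refine hφ.hasDistribution_of_momentGF_eq h.right_pos.isSelfAdjoint
      (isCompact_singleton (x := (φ Y⁻¹ʳ).re⁻¹)) (by simp) ?_
    filter_upwards [h.eventually_momentGF_right] with v hv
    rw [integral_dirac]
    refine eq_inv_of_mul_eq_one_left ?_
    rw [← hcd] at hv
    field_simp
    linear_combination hv

end IsMatsumotoYorPair

end MatsumotoYor

section Semicircle

open Real

theorem poissonKernel_mul_re_one_sub_sq_circleMap (v θ : ℝ) :
    poissonKernel 0 v (circleMap 0 1 θ) * ((1 - circleMap 0 1 θ ^ 2) / 2).re =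
      (1 - v ^ 2) * (sin θ ^ 2 / (1 - 2 * v * cos θ + v ^ 2)) := by
  have hcircle : circleMap 0 1 θ = ⟨cos θ, sin θ⟩ := by
    simp [Complex.ext_iff, circleMap_zero, Complex.exp_ofReal_mul_I_re,
      Complex.exp_ofReal_mul_I_im]
  have hnorm : ‖circleMap 0 1 θ - v‖ ^ 2 = 1 - 2 * v * cos θ + v ^ 2 := by
    rw [hcircle, Complex.sq_norm, Complex.normSq_apply]
    simp only [Complex.sub_re, Complex.sub_im, Complex.ofReal_re, Complex.ofReal_im]
    linear_combination sin_sq_add_cos_sq θ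
  have hre : ((1 - circleMap 0 1 θ ^ 2) / 2).re = sin θ ^ 2 := by
    rw [hcircle, Complex.div_ofNat_re]
    simp only [pow_two, Complex.sub_re, Complex.one_re, Complex.mul_re]
    linear_combination (-1 / 2 : ℝ) * sin_sq_add_cos_sq θ
  rw [hre, poissonKernel_def, sub_zero, sub_zero, hnorm, norm_circleMap_zero, Complex.norm_real,
    norm_eq_abs, sq_abs, sq_abs]
  ring

theorem integral_sin_sq_div {v : ℝ} (hv : |v| < 1) :
    ∫ θ in 0..π, sin θ ^ 2 / (1 - 2 * v * cos θ + v ^ 2) = π / 2 := by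
  set f : ℝ → ℝ := fun θ => sin θ ^ 2 / (1 - 2 * v * cos θ + v ^ 2)
  have hpos : ∀ θ, 0 < 1 - 2 * v * cos θ + v ^ 2 := fun θ => by
    have hvcos : v * cos θ < 1 := (le_abs_self _).trans_lt <|
      (abs_mul v _).trans_lt <| mul_lt_one_of_nonneg_of_lt_one_left (abs_nonneg v) hv
        (abs_cos_le_one θ)
    calc 0 < (1 - v * cos θ) ^ 2 + (v * sin θ) ^ 2 := by
            have := sub_pos.2 hvcos
            positivity
      _ = 1 - 2 * v * cos θ + v ^ 2 := by linear_combination v ^ 2 * sin_sq_add_cos_sq θ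
  have hf : Continuous f :=
    Continuous.div (by fun_prop) (by fun_prop) fun θ => (hpos θ).ne'
  have hsymm : ∫ θ in π..2 * π, f θ = ∫ θ in 0..π, f θ := by
    have h := intervalIntegral.integral_comp_sub_left (a := 0) (b := π) f (2 * π)
    rw [sub_zero, two_mul, add_sub_cancel_right, ← two_mul] at h
    simpa [f] using h.symm
  have hpoisson := InnerProductSpace.HarmonicOnNhd.circleAverage_poissonKernel_smul
    (f := fun z => ((1 - z ^ 2) / 2).re) (c := 0) (R := 1) (w := v)
    (fun z _ => AnalyticAt.harmonicAt_re (f := fun z : ℂ => (1 - z ^ 2) / 2) (by fun_prop))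
    (by simpa using hv)
  have hv2 : 1 - v ^ 2 ≠ 0 := (sub_pos.2 ((sq_lt_one_iff_abs_lt_one v).2 hv)).ne'
  have hvalue : ((1 - (v : ℂ) ^ 2) / 2).re = (1 - v ^ 2) / 2 := by
    norm_cast
  simp only [circleAverage_def, Pi.mul_apply, smul_eq_mul,
    poissonKernel_mul_re_one_sub_sq_circleMap] at hpoisson
  rw [intervalIntegral.integral_const_mul, hvalue,
    ← intervalIntegral.integral_add_adjacent_intervals (hf.intervalIntegrable 0 π)
      (hf.intervalIntegrable π (2 * π)), hsymm] at hpoisson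
  field_simp at hpoisson
  linarith

variable {a b : ℝ}

theorem integral_eq_integral_cos (hab : a ≤ b) {g : ℝ → ℝ} (hg : ContinuousOn g (Set.Icc a b)) :
    ∫ t in a..b, g t = ∫ θ in 0..π,
      g ((a + b) / 2 + (b - a) / 2 * cos θ) * ((b - a) / 2 * sin θ) := by
  have hrange : ∀ θ : ℝ, (a + b) / 2 + (b - a) / 2 * cos θ ∈ Set.Icc a b := fun θ => by
    constructor <;> nlinarith [cos_le_one θ, neg_one_le_cos θ]
  have h := intervalIntegral.integral_comp_mul_deriv' (a := 0) (b := π)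
    (f := fun θ => (a + b) / 2 + (b - a) / 2 * cos θ) (f' := fun θ => (b - a) / 2 * -sin θ)
    (g := g) (fun θ _ => ((hasDerivAt_cos θ).const_mul _).const_add _) (by fun_prop)
    (hg.mono (Set.image_subset_iff.2 fun θ _ => hrange θ))
  have hb : (a + b) / 2 + (b - a) / 2 * cos 0 = b := by rw [cos_zero]; ring
  have ha : (a + b) / 2 + (b - a) / 2 * cos π = a := by rw [cos_pi]; ring
  simp only [hb, ha, Function.comp_apply, mul_neg, intervalIntegral.integral_neg] at h
  rw [intervalIntegral.integral_symm, ← h, neg_neg]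

theorem sqrt_eq_mul_sin (hab : a ≤ b) {θ : ℝ} (hθ : θ ∈ Set.Icc 0 π) :
    √(((a + b) / 2 + (b - a) / 2 * cos θ - a) * (b - ((a + b) / 2 + (b - a) / 2 * cos θ))) =
      (b - a) / 2 * sin θ := by
  rw [show ((a + b) / 2 + (b - a) / 2 * cos θ - a) * (b - ((a + b) / 2 + (b - a) / 2 * cos θ)) =
    ((b - a) / 2 * sin θ) ^ 2 by linear_combination (-((b - a) / 2) ^ 2) * sin_sq_add_cos_sq θ]
  exact sqrt_sq (mul_nonneg (by linarith) (sin_nonneg_of_mem_Icc hθ))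

theorem integral_sqrt_div_sub_mul (hab : a ≤ b) {p q : ℝ} (hpa : 0 < p - q * a)
    (hpb : 0 < p - q * b) :
    ∫ t in a..b, √((t - a) * (b - t)) / (p - q * t) =
      π * ((b - a) / 2) ^ 2 / (p - q * ((a + b) / 2) + √((p - q * a) * (p - q * b))) := by
  have hm : 0 < p - q * ((a + b) / 2) := by linarith
  set s := √((p - q * a) * (p - q * b))
  set m := p - q * ((a + b) / 2)
  have hs : s ^ 2 = m ^ 2 - (q * ((b - a) / 2)) ^ 2 := by
    rw [sq_sqrt (mul_pos hpa hpb).le]; ring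
  have hs0 : 0 < s := sqrt_pos.2 (mul_pos hpa hpb)
  -- `v` is the root in the unit disc for which `p - q * t` is a multiple of `|exp (θ * I) - v| ^ 2`
  set v := q * ((b - a) / 2) / (m + s)
  have hv : |v| < 1 := by
    rw [abs_div, abs_of_pos (add_pos hm hs0), div_lt_one (add_pos hm hs0)]
    exact (abs_lt_of_sq_lt_sq (by nlinarith) hm.le).trans (lt_add_of_pos_right m hs0)
  have hvs : v * (m + s) = q * ((b - a) / 2) := div_mul_cancel₀ _ (add_pos hm hs0).ne'
  have hden : ∀ θ, p - q * ((a + b) / 2 + (b - a) / 2 * cos θ) =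
      (m + s) / 2 * (1 - 2 * v * cos θ + v ^ 2) := by
    intro θ
    have hsq : (m + s) * v ^ 2 = m - s := by
      refine mul_left_cancel₀ (add_pos hm hs0).ne' ?_
      linear_combination (v * (m + s) + q * ((b - a) / 2)) * hvs + hs
    linear_combination cos θ * hvs - hsq / 2
  have hcont : ContinuousOn (fun t => √((t - a) * (b - t)) / (p - q * t)) (Set.Icc a b) :=
    ContinuousOn.div (by fun_prop) (by fun_prop) fun t ht => ne_of_gt <| by
      rcases le_total 0 q with hq | hq
      · linarith [mul_le_mul_of_nonneg_left ht.2 hq]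
      · linarith [mul_le_mul_of_nonpos_left ht.1 hq]
  have hintegrand : ∀ θ ∈ Set.uIcc 0 π,
      √(((a + b) / 2 + (b - a) / 2 * cos θ - a) * (b - ((a + b) / 2 + (b - a) / 2 * cos θ))) /
        (p - q * ((a + b) / 2 + (b - a) / 2 * cos θ)) * ((b - a) / 2 * sin θ) =
      2 * ((b - a) / 2) ^ 2 / (m + s) * (sin θ ^ 2 / (1 - 2 * v * cos θ + v ^ 2)) := by
    intro θ hθ
    rw [Set.uIcc_of_le pi_pos.le] at hθ
    rw [sqrt_eq_mul_sin hab hθ, hden]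
    field_simp
  rw [integral_eq_integral_cos hab hcont, intervalIntegral.integral_congr hintegrand,
    intervalIntegral.integral_const_mul, integral_sin_sq_div hv]
  ring

theorem integral_sqrt_div_self (ha : 0 < a) (hab : a ≤ b) :
    ∫ t in a..b, √((t - a) * (b - t)) / t = π * ((a + b) / 2 - √(a * b)) := by
  have hb : 0 < b := ha.trans_le hab
  have hs : √(a * b) ^ 2 = a * b := sq_sqrt (mul_pos ha hb).le
  have h := integral_sqrt_div_sub_mul hab (p := 0) (q := -1) (by linarith) (by linarith)
  simp only [neg_mul, one_mul, sub_neg_eq_add, zero_add] at h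
  rw [h, div_eq_iff (by positivity)]
  linear_combination π * hs

theorem integral_sqrt_div_sq (ha : 0 < a) (hab : a ≤ b) :
    ∫ t in a..b, √((t - a) * (b - t)) / t ^ 2 = π * ((a + b) / 2 / √(a * b) - 1) := by
  have hb : 0 < b := ha.trans_le hab
  have hpos : ∀ t ∈ Set.uIcc a b, 0 < t := fun t ht =>
    ha.trans_le (Set.uIcc_of_le hab ▸ ht).1
  have himage : ∀ t ∈ Set.uIcc a b, 0 < a * b / t := fun t ht =>
    div_pos (mul_pos ha hb) (hpos t ht)
  have hsubst := intervalIntegral.integral_comp_mul_deriv' (a := a) (b := b)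
    (f := fun t => a * b / t) (f' := fun t => -(a * b) / t ^ 2)
    (g := fun t => √((t - a) * (b - t)) / t ^ 2)
    (fun t ht => by
      simpa using (hasDerivAt_const t (a * b)).fun_div (hasDerivAt_id' t) (hpos t ht).ne')
    (ContinuousOn.div (by fun_prop) (by fun_prop) fun t ht => pow_ne_zero 2 (hpos t ht).ne')
    (ContinuousOn.div (by fun_prop) (by fun_prop)
      (Set.forall_mem_image.2 fun t ht => pow_ne_zero 2 (himage t ht).ne'))
  have hintegrand : ∀ t ∈ Set.uIcc a b,
      √((a * b / t - a) * (b - a * b / t)) / (a * b / t) ^ 2 * (-(a * b) / t ^ 2) =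
        -(√(a * b))⁻¹ * (√((t - a) * (b - t)) / t) := by
    intro t ht
    have ht0 := hpos t ht
    have hroot : √((a * b / t - a) * (b - a * b / t)) = √(a * b) * √((t - a) * (b - t)) / t := by
      rw [← sqrt_mul (mul_pos ha hb).le, ← sqrt_sq ht0.le, ← sqrt_div' _ (sq_nonneg t),
        sqrt_sq ht0.le]
      congr 1
      field_simp
    have hs : √(a * b) ^ 2 = a * b := sq_sqrt (mul_pos ha hb).le
    rw [hroot]
    field_simp
    linear_combination √((t - a) * (b - t)) * -hs
  simp only [Function.comp_apply, mul_div_cancel_left₀ _ ha.ne', mul_div_cancel_right₀ _ hb.ne',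
    intervalIntegral.integral_congr hintegrand, intervalIntegral.integral_const_mul] at hsubst
  rw [intervalIntegral.integral_symm, ← hsubst, integral_sqrt_div_self ha hab]
  field_simp

end Semicircle

section GIG

/-- The common form of the free Poisson density (`η = 0`) and of the free generalized inverse
Gaussian density (`η = β / √(a * b)`) on their support `[a, b]`. -/
def gigDensity (a b α η x : ℝ) : ℝ :=
  1 / (2 * Real.pi) * √((x - a) * (b - x)) * (α / x + η / x ^ 2)

/-- The measure on `[a, b]` with density `gigDensity a b α η`. -/
def gigMeasure (a b α η : ℝ) : Measure ℝ :=
  (volume.restrict (Set.Icc a b)).withDensity fun x => ENNReal.ofReal (gigDensity a b α η x)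

variable {a b α η : ℝ}

theorem continuousOn_gigDensity (ha : 0 < a) :
    ContinuousOn (gigDensity a b α η) (Set.Icc a b) := by
  have hne : ∀ t ∈ Set.Icc a b, t ≠ 0 := fun t ht => (ha.trans_le ht.1).ne'
  refine ContinuousOn.mul (by fun_prop) (ContinuousOn.add ?_ ?_)
  · exact ContinuousOn.div (by fun_prop) (by fun_prop) hne
  · exact ContinuousOn.div (by fun_prop) (by fun_prop) fun t ht => pow_ne_zero 2 (hne t ht)

theorem gigDensity_nonneg (ha : 0 < a) (hα : 0 ≤ α) (hη : 0 ≤ η) {x : ℝ} (hx : a ≤ x) :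
    0 ≤ gigDensity a b α η x := by
  have : 0 < x := ha.trans_le hx
  have := Real.pi_pos
  unfold gigDensity
  positivity

theorem isFiniteMeasure_gigMeasure (ha : 0 < a) : IsFiniteMeasure (gigMeasure a b α η) :=
  isFiniteMeasure_withDensity_ofReal
    (continuousOn_gigDensity ha).integrableOn_Icc.hasFiniteIntegral

theorem gigMeasure_compl_Icc : gigMeasure a b α η (Set.Icc a b)ᶜ = 0 := by
  refine withDensity_absolutelyContinuous _ _ ?_
  rw [Measure.restrict_apply measurableSet_Icc.compl, Set.compl_inter_self, measure_empty]

theorem integral_gigMeasure (ha : 0 < a) (hab : a ≤ b) (hα : 0 ≤ α) (hη : 0 ≤ η) (f : ℝ → ℝ) :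
    ∫ t, f t ∂gigMeasure a b α η = ∫ t in a..b, gigDensity a b α η t * f t := by
  rw [gigMeasure, integral_withDensity_eq_integral_toReal_smul₀
      ((continuousOn_gigDensity ha).aemeasurable measurableSet_Icc).ennreal_ofReal
      (Eventually.of_forall fun _ => ENNReal.ofReal_lt_top),
    intervalIntegral.integral_of_le hab, ← integral_Icc_eq_integral_Ioc]
  refine setIntegral_congr_fun measurableSet_Icc fun t ht => ?_
  rw [ENNReal.toReal_ofReal (gigDensity_nonneg ha hα hη ht.1), smul_eq_mul]

theorem gigDensity_mul_inv_one_sub_mul {u t : ℝ} (ht : t ≠ 0) (hut : 1 - u * t ≠ 0) :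
    gigDensity a b α η t * (1 - u * t)⁻¹ =
      (2 * Real.pi)⁻¹ * ((α + η * u) * (√((t - a) * (b - t)) / t) +
        η * (√((t - a) * (b - t)) / t ^ 2) +
        u * (α + η * u) * (√((t - a) * (b - t)) / (1 - u * t))) := by
  have hpartial : (α / t + η / t ^ 2) * (1 - u * t)⁻¹ =
      (α + η * u) / t + η / t ^ 2 + u * (α + η * u) / (1 - u * t) := by
    rw [← div_eq_mul_inv, div_eq_iff hut, add_mul, div_mul_cancel₀ _ hut]
    field_simp
    ring
  rw [gigDensity, mul_assoc, hpartial]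
  ring

theorem integral_gigDensity_mul_inv (ha : 0 < a) (hab : a ≤ b) {u : ℝ} (hu : u * b < 1) :
    ∫ t in a..b, gigDensity a b α η t * (1 - u * t)⁻¹ =
      2⁻¹ * ((α + η * u) * ((a + b) / 2 - √(a * b)) + η * ((a + b) / 2 / √(a * b) - 1) +
        u * (α + η * u) * (((b - a) / 2) ^ 2 /
          (1 - u * ((a + b) / 2) + √((1 - u * a) * (1 - u * b))))) := by
  have hne : ∀ t ∈ Set.uIcc a b, 0 < t ∧ 0 < 1 - u * t := fun t ht => by
    rw [Set.uIcc_of_le hab] at ht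
    refine ⟨ha.trans_le ht.1, ?_⟩
    rcases le_total 0 u with hu0 | hu0
    · linarith [mul_le_mul_of_nonneg_left ht.2 hu0]
    · linarith [mul_nonpos_of_nonpos_of_nonneg hu0 (ha.le.trans ht.1)]
  have hint : ∀ f : ℝ → ℝ, ContinuousOn f (Set.uIcc a b) → (∀ t ∈ Set.uIcc a b, f t ≠ 0) →
      IntervalIntegrable (fun t => √((t - a) * (b - t)) / f t) volume a b := fun f hf hf0 =>
    (ContinuousOn.div (by fun_prop) hf hf0).intervalIntegrable
  have hint₁ := hint (fun t => t) (by fun_prop) fun t ht => (hne t ht).1.ne'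
  have hint₂ := hint (fun t => t ^ 2) (by fun_prop) fun t ht => (pow_pos (hne t ht).1 2).ne'
  have hint₃ := hint (fun t => 1 - u * t) (by fun_prop) fun t ht => (hne t ht).2.ne'
  rw [intervalIntegral.integral_congr fun t ht =>
      gigDensity_mul_inv_one_sub_mul (hne t ht).1.ne' (hne t ht).2.ne',
    intervalIntegral.integral_const_mul,
    intervalIntegral.integral_add ((hint₁.const_mul _).add (hint₂.const_mul _))
      (hint₃.const_mul _),
    intervalIntegral.integral_add (hint₁.const_mul _) (hint₂.const_mul _),
    intervalIntegral.integral_const_mul, intervalIntegral.integral_const_mul,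
    intervalIntegral.integral_const_mul, integral_sqrt_div_self ha hab,
    integral_sqrt_div_sq ha hab, integral_sqrt_div_sub_mul hab
      (hne a Set.left_mem_uIcc).2 (hne b Set.right_mem_uIcc).2]
  field_simp

theorem two_mul_integral_gigDensity_mul_inv (ha : 0 < a) (hab : a ≤ b) {u : ℝ}
    (hua : u * a < 1) (hub : u * b < 1) :
    2 * u * ∫ t in a..b, gigDensity a b α η t * (1 - u * t)⁻¹ =
      α + (η * ((a + b) / 2) / √(a * b) - α * √(a * b)) * u - η * √(a * b) * u ^ 2 -
        (α + η * u) * √((1 - u * a) * (1 - u * b)) := by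
  have hD : √((1 - u * a) * (1 - u * b)) ^ 2 = (1 - u * a) * (1 - u * b) :=
    Real.sq_sqrt (mul_pos (sub_pos.2 hua) (sub_pos.2 hub)).le
  have hden : 0 < 1 - u * ((a + b) / 2) + √((1 - u * a) * (1 - u * b)) := by
    linarith [Real.sqrt_nonneg ((1 - u * a) * (1 - u * b))]
  have hrationalize : u ^ 2 * (((b - a) / 2) ^ 2 /
      (1 - u * ((a + b) / 2) + √((1 - u * a) * (1 - u * b)))) =
        1 - u * ((a + b) / 2) - √((1 - u * a) * (1 - u * b)) := by
    rw [← mul_div_assoc, div_eq_iff hden.ne']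
    linear_combination hD
  rw [integral_gigDensity_mul_inv ha hab hub]
  linear_combination (α + η * u) * hrationalize

/-- The discriminant of the quadratic polynomial `gigQuadratic α l β k u` in `m`. -/
def gigDiscr (α l β k u : ℝ) : ℝ :=
  (α + l * u - β * u ^ 2) ^ 2 - 4 * u * (α + k * u)

theorem sq_eq_gigDiscr {l β k u m : ℝ} (h : gigQuadratic α l β k u m = 0) :
    (α + l * u - β * u ^ 2 - 2 * u * m) ^ 2 = gigDiscr α l β k u := by
  rw [gigQuadratic] at h
  rw [gigDiscr]
  linear_combination 4 * u * h

theorem IsState.hasDistribution_gigMeasure {A : Type*} [CStarAlgebra A] [PartialOrder A]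
    [StarOrderedRing A] {φ : A →ₗ[ℂ] ℂ} {X : A} (hφ : IsState φ) (hX : IsSelfAdjoint X)
    {l β k : ℝ} (ha : 0 < a) (hab : a ≤ b) (hα : 0 < α) (hη : 0 ≤ η) (hβ : β = η * √(a * b))
    (hl : l = η * ((a + b) / 2) / √(a * b) - α * √(a * b))
    (hdiscr : ∀ u, gigDiscr α l β k u = (α + η * u) ^ 2 * ((1 - u * a) * (1 - u * b)))
    (hquad : ∀ᶠ u in 𝓝 0, gigQuadratic α l β k u (momentGF φ X u) = 0) :
    HasDistribution φ X (gigMeasure a b α η) := by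
  have hfinite : IsFiniteMeasure (gigMeasure a b α η) := isFiniteMeasure_gigMeasure ha
  have hM : ContinuousAt (momentGF φ X) 0 :=
    (hasStrictDerivAt_momentGF_zero hφ.continuous).hasDerivAt.continuousAt
  have hua : ∀ᶠ u : ℝ in 𝓝 0, u * a < 1 :=
    ContinuousAt.eventually_lt (by fun_prop) continuousAt_const (by simp)
  have hub : ∀ᶠ u : ℝ in 𝓝 0, u * b < 1 :=
    ContinuousAt.eventually_lt (by fun_prop) continuousAt_const (by simp)
  have hleft : ∀ᶠ u in 𝓝 0, 0 < α + l * u - β * u ^ 2 - 2 * u * momentGF φ X u :=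
    ContinuousAt.eventually_lt (by fun_prop) (by fun_prop) (by simpa using hα)
  have hright : ∀ᶠ u : ℝ in 𝓝 0, 0 < α + η * u :=
    ContinuousAt.eventually_lt (by fun_prop) (by fun_prop) (by simpa using hα)
  refine hφ.hasDistribution_of_momentGF_eq hX isCompact_Icc gigMeasure_compl_Icc ?_
  refine (ContinuousAt.eventuallyEq_nhds_iff_eventuallyEq_nhdsNE hM
    (hasFPowerSeriesAt_integral_inv_one_sub_mul isCompact_Icc
      gigMeasure_compl_Icc).continuousAt).1 ?_
  filter_upwards [nhdsWithin_le_nhds hquad, nhdsWithin_le_nhds hua, nhdsWithin_le_nhds hub,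
    nhdsWithin_le_nhds hleft, nhdsWithin_le_nhds hright, self_mem_nhdsWithin]
    with u hquad hua hub hleft hright hu
  have hroot : α + l * u - β * u ^ 2 - 2 * u * momentGF φ X u =
      (α + η * u) * √((1 - u * a) * (1 - u * b)) := by
    refine (pow_left_inj₀ hleft.le (by positivity) two_ne_zero).1 ?_
    rw [sq_eq_gigDiscr hquad, hdiscr, mul_pow,
      Real.sq_sqrt (mul_pos (sub_pos.2 hua) (sub_pos.2 hub)).le]
  have hintegral := two_mul_integral_gigDensity_mul_inv (α := α) (η := η) ha hab hua hub
  rw [← hl, ← hβ] at hintegral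
  rw [integral_gigMeasure ha hab hα.le hη]
  refine mul_left_cancel₀ (mul_ne_zero two_ne_zero hu) ?_
  linear_combination -hroot - hintegral

end GIG

section FreePoisson

variable {lam α : ℝ}

theorem freePoisson_one_div_eq_gigMeasure (hlam : 1 < lam) :
    freePoisson lam (1 / α) =
      gigMeasure (1 / α * (1 - √lam) ^ 2) (1 / α * (1 + √lam) ^ 2) α 0 := by
  have hs : √lam ^ 2 = lam := Real.sq_sqrt (by linarith)
  rw [freePoisson, gigMeasure, max_eq_left (by linarith), ENNReal.ofReal_zero, zero_smul, zero_add,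
    Measure.restrict_congr_set Ioo_ae_eq_Icc]
  congr 1
  funext x
  have hradicand : 4 * lam * (1 / α) ^ 2 - (x - 1 / α * (1 + lam)) ^ 2 =
      (x - 1 / α * (1 - √lam) ^ 2) * (1 / α * (1 + √lam) ^ 2 - x) := by
    nth_rw 1 2 [← hs]
    ring
  rw [gigDensity, hradicand, zero_div, add_zero]
  congr 1
  field_simp

theorem IsState.hasDistribution_freePoisson {A : Type*} [CStarAlgebra A] [PartialOrder A]
    [StarOrderedRing A] {φ : A →ₗ[ℂ] ℂ} {Y : A} (hφ : IsState φ) (hY : IsSelfAdjoint Y)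
    (hlam : 1 < lam) (hα : 0 < α)
    (hquad : ∀ᶠ v in 𝓝 0, gigQuadratic α (1 - lam) 0 0 v (momentGF φ Y v) = 0) :
    HasDistribution φ Y (freePoisson lam (1 / α)) := by
  have hs : √lam ^ 2 = lam := Real.sq_sqrt (by linarith)
  have hs1 : 1 < √lam := Real.lt_sqrt_of_sq_lt (by linarith)
  have hroot : √(1 / α * (1 - √lam) ^ 2 * (1 / α * (1 + √lam) ^ 2)) = (lam - 1) / α := by
    rw [show 1 / α * (1 - √lam) ^ 2 * (1 / α * (1 + √lam) ^ 2) = ((√lam ^ 2 - 1) / α) ^ 2 by ring,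
      hs]
    exact Real.sqrt_sq (div_nonneg (by linarith) hα.le)
  have hne : 1 - √lam ≠ 0 := by linarith
  rw [freePoisson_one_div_eq_gigMeasure hlam]
  refine hφ.hasDistribution_gigMeasure hY (by positivity) ?_ hα le_rfl (zero_mul _).symm ?_ ?_
    hquad
  · exact mul_le_mul_of_nonneg_left (by linarith) (by positivity)
  · rw [hroot, zero_mul, zero_div]
    field_simp
    ring
  · intro u
    rw [gigDiscr]
    nth_rw 1 [← hs]
    field_simp
    ring

end FreePoisson

section Roots

variable {A : Type*} [CStarAlgebra A] [PartialOrder A] [StarOrderedRing A] {φ : A →ₗ[ℂ] ℂ}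
  {X : A} {α l β k η : ℝ}

theorem gigQuadratic_momentGF_eq_zero (hφ : IsState φ) (hX : 0 ≤ X)
    (hquad : ∀ᶠ u in 𝓝 0, gigQuadratic α l β k u (momentGF φ X u) = 0) {u : ℝ}
    (hu : u * ‖X‖ < 1) : gigQuadratic α l β k u (momentGF φ X u) = 0 := by
  have hM := analyticOnNhd_momentGF hφ hX
  have hanalytic : AnalyticOnNhd ℝ (fun u => gigQuadratic α l β k u (momentGF φ X u))
      {u | u * ‖X‖ < 1} := fun t ht => by
    have := hM t ht
    unfold gigQuadratic
    fun_prop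
  have hconvex : Convex ℝ {u : ℝ | u * ‖X‖ < 1} :=
    convex_halfSpace_lt (LinearMap.isLinear (LinearMap.mulRight ℝ ‖X‖)) 1
  exact hanalytic.eqOn_zero_of_preconnected_of_eventuallyEq_zero hconvex.isPreconnected
    (by simp) hquad hu

theorem exists_neg_root {f : ℝ → ℝ} (hf : ContinuousOn f (Set.Iic 0)) (hf1 : ∀ u ≤ 0, f u ≤ 1)
    (hα : 0 < α) (hβ : 0 < β) (hl : 0 ≤ l) : ∃ ρ < 0, α + l * ρ - β * ρ ^ 2 - 2 * ρ * f ρ = 0 := by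
  set K := 1 + (α + 2) / β
  have hK : 1 < K := lt_add_of_pos_right 1 (by positivity)
  have hβK : β * K = β + α + 2 := by
    simp only [K]
    field_simp
    ring
  have hcont : ContinuousOn (fun u => α + l * u - β * u ^ 2 - 2 * u * f u) (Set.Icc (-K) 0) := by
    have := hf.mono (Set.Icc_subset_Iic_self (a := -K))
    fun_prop
  have hneg : α + l * -K - β * (-K) ^ 2 - 2 * -K * f (-K) ≤ 0 := by
    have h1 := mul_le_mul_of_nonneg_left (hf1 (-K) (by linarith)) (by linarith : 0 ≤ K)
    have h2 := mul_nonneg hl (by linarith : 0 ≤ K)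
    nlinarith
  obtain ⟨ρ, hρ, hroot⟩ := intermediate_value_Icc (by linarith) hcont ⟨hneg, by simpa using hα.le⟩
  refine ⟨ρ, lt_of_le_of_ne hρ.2 ?_, hroot⟩
  rintro rfl
  simp [hα.ne'] at hroot

theorem hasDerivAt_gigDiscr (α l β k u : ℝ) :
    HasDerivAt (gigDiscr α l β k)
      (2 * (α + l * u - β * u ^ 2) * (l - 2 * β * u) - 4 * α - 8 * k * u) u := by
  have hid := hasDerivAt_id' u
  have hsq := ((((hid.const_mul l).const_add α).fun_sub ((hid.fun_pow 2).const_mul β)).fun_pow 2)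
  exact (hsq.fun_sub ((hid.const_mul 4).fun_mul ((hid.const_mul k).const_add α))).congr_deriv
    (by push_cast; ring)

theorem gigDiscr_eq_of_double_root {ρ r s : ℝ} (hρ : ρ ≠ 0) (hα : α = -(η * ρ))
    (hβ : β = η * r) (hs : η * s = 2 * r * (α * r + l)) (hzero : gigDiscr α l β k ρ = 0)
    (hderiv : 2 * (α + l * ρ - β * ρ ^ 2) * (l - 2 * β * ρ) - 4 * α - 8 * k * ρ = 0) (u : ℝ) :
    gigDiscr α l β k u = (α + η * u) ^ 2 * (1 - s * u + r ^ 2 * u ^ 2) := by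
  -- The two sides differ by `u * (p + q * u)`, which has a double root at `ρ ≠ 0`.
  set p := 2 * α * l - 4 * α - 2 * α * η + s * α ^ 2 with hp
  set q := l ^ 2 - 2 * α * β - 4 * k - η ^ 2 + 2 * α * η * s - α ^ 2 * r ^ 2 with hq
  have hdiff : ∀ u, gigDiscr α l β k u =
      (α + η * u) ^ 2 * (1 - s * u + r ^ 2 * u ^ 2) + u * (p + q * u) := fun u => by
    rw [gigDiscr, hp, hq, hβ]
    linear_combination η * u ^ 3 * hs
  have hroot : p + q * ρ = 0 := by
    have h := hdiff ρ
    rw [hzero, hα] at h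
    refine (mul_eq_zero.1 ?_).resolve_left hρ
    linear_combination -h
  have hroot' : p + 2 * q * ρ = 0 := by
    rw [hp, hq]
    rw [hα] at hs hderiv ⊢
    rw [hβ] at hderiv ⊢
    linear_combination hderiv - 3 * η * ρ ^ 2 * hs
  have hq0 : q = 0 := by
    refine (mul_eq_zero.1 ?_).resolve_right hρ
    linear_combination hroot' - hroot
  rw [hdiff, show p = 0 by simpa [hq0] using hroot, hq0]
  ring

theorem exists_add_eq_and_mul_eq_sq {r s : ℝ} (hr : 0 < r) (hrs : 2 * r < s) :
    ∃ a b : ℝ, 0 < a ∧ a < b ∧ a + b = s ∧ a * b = r ^ 2 := by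
  have hdisc : 0 < s ^ 2 - 4 * r ^ 2 := by nlinarith
  have hsq := Real.sq_sqrt hdisc.le
  have hpos := Real.sqrt_pos.2 hdisc
  have hlt : √(s ^ 2 - 4 * r ^ 2) < s := (Real.sqrt_lt' (by linarith)).2 (by nlinarith)
  refine ⟨(s - √(s ^ 2 - 4 * r ^ 2)) / 2, (s + √(s ^ 2 - 4 * r ^ 2)) / 2, by linarith,
    by linarith, by ring, ?_⟩
  linear_combination -hsq / 4

theorem exists_gigDiscr_eq {ρ : ℝ} (hα : 0 < α) (hβ : 0 < β) (hρ : ρ < 0)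
    (hneg : α + l * ρ - β * ρ ^ 2 < 0) (hzero : gigDiscr α l β k ρ = 0)
    (hmin : IsLocalMin (gigDiscr α l β k) ρ) :
    ∃ a b η : ℝ, 0 < a ∧ a < b ∧ 0 < η ∧ β = η * √(a * b) ∧
      ∀ u, gigDiscr α l β k u = (α + η * u) ^ 2 * ((1 - u * a) * (1 - u * b)) := by
  have hη : 0 < -α / ρ := div_pos_of_neg_of_neg (neg_neg_of_pos hα) hρ
  have hαη : α = -(-α / ρ * ρ) := by
    rw [div_mul_cancel₀ _ hρ.ne, neg_neg]
  generalize -α / ρ = η at hη hαη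
  obtain ⟨r, hr⟩ : ∃ r, r = β / η := ⟨_, rfl⟩
  have hr0 : 0 < r := hr ▸ div_pos hβ hη
  have hβr : β = η * r := by rw [hr, mul_div_cancel₀ _ hη.ne']
  obtain ⟨s, hs⟩ : ∃ s, s = 2 * r * (α * r + l) / η := ⟨_, rfl⟩
  have hηs : η * s = 2 * r * (α * r + l) := by rw [hs, mul_div_cancel₀ _ hη.ne']
  have hrs : 2 * r < s := by
    have hηl : η < α * r + l := by
      refine lt_of_mul_lt_mul_left ?_ (neg_nonneg.2 hρ.le)
      rw [hαη, hβr] at hneg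
      rw [hαη]
      linarith
    rw [hs, lt_div_iff₀ hη]
    exact mul_lt_mul_of_pos_left hηl (by positivity)
  obtain ⟨a, b, ha, hab, hadd, hmul⟩ := exists_add_eq_and_mul_eq_sq hr0 hrs
  refine ⟨a, b, η, ha, hab, hη, by rw [hmul, Real.sqrt_sq hr0.le, hβr], fun u => ?_⟩
  rw [gigDiscr_eq_of_double_root hρ.ne hαη hβr hηs hzero
    (hmin.hasDerivAt_eq_zero (hasDerivAt_gigDiscr α l β k ρ)), ← hmul, ← hadd]
  ring

theorem IsState.exists_gigDiscr_eq (hφ : IsState φ) (hX : 0 ≤ X) (hα : 0 < α) (hβ : 0 < β)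
    (hl : 0 ≤ l) (hquad : ∀ᶠ u in 𝓝 0, gigQuadratic α l β k u (momentGF φ X u) = 0) :
    ∃ a b η : ℝ, 0 < a ∧ a < b ∧ 0 < η ∧ β = η * √(a * b) ∧
      ∀ u, gigDiscr α l β k u = (α + η * u) ^ 2 * ((1 - u * a) * (1 - u * b)) := by
  have hmem : ∀ u ≤ 0, u * ‖X‖ < 1 := fun u hu =>
    (mul_nonpos_of_nonpos_of_nonneg hu (norm_nonneg X)).trans_lt one_pos
  have hdiscr : ∀ u ≤ 0, (α + l * u - β * u ^ 2 - 2 * u * momentGF φ X u) ^ 2 =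
      gigDiscr α l β k u := fun u hu =>
    sq_eq_gigDiscr (gigQuadratic_momentGF_eq_zero hφ hX hquad (hmem u hu))
  obtain ⟨ρ, hρ, hroot⟩ := exists_neg_root
    ((analyticOnNhd_momentGF hφ hX).continuousOn.mono hmem)
    (fun u hu => momentGF_le_one hφ hX hu) hα hβ hl
  have hzero : gigDiscr α l β k ρ = 0 := by rw [← hdiscr ρ hρ.le, hroot, zero_pow two_ne_zero]
  refine FreeMY.exists_gigDiscr_eq hα hβ hρ ?_ hzero ?_
  · linarith [mul_neg_of_neg_of_pos hρ (momentGF_pos hφ hX (hmem ρ hρ.le))]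
  · filter_upwards [Iio_mem_nhds hρ] with u hu
    rw [hzero, ← hdiscr u (le_of_lt hu)]
    exact sq_nonneg _

theorem gig_equations_of_gigDiscr_eq {a b : ℝ} (ha : 0 < a) (hab : a < b) (hα : α ≠ 0)
    (hη : η ≠ 0) (hβ : β = η * √(a * b))
    (hdiscr : ∀ u, gigDiscr α l β k u = (α + η * u) ^ 2 * ((1 - u * a) * (1 - u * b))) :
    l + α * √(a * b) - β * ((a + b) / (2 * (a * b))) = 0 ∧
      2 - l + β / √(a * b) - α * ((a + b) / 2) = 0 := by
  have hab0 : 0 < a * b := mul_pos ha (ha.trans hab)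
  have hs : √(a * b) ^ 2 = a * b := Real.sq_sqrt hab0.le
  have hs0 : √(a * b) ≠ 0 := (Real.sqrt_pos.2 hab0).ne'
  simp only [gigDiscr] at hdiscr
  have hcoeff₁ : α * (2 - l + η - α * ((a + b) / 2)) = 0 := by
    linear_combination (-1 / 3 : ℝ) * (hdiscr 1 - hdiscr (-1)) +
      (1 / 24 : ℝ) * (hdiscr 2 - hdiscr (-2))
  have hcoeff₃ : -2 * l * β = 2 * α * η * (a * b) - η ^ 2 * (a + b) := by
    linear_combination (-1 / 6 : ℝ) * (hdiscr 1 - hdiscr (-1)) +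
      (1 / 12 : ℝ) * (hdiscr 2 - hdiscr (-2))
  constructor
  · refine (mul_eq_zero.1 ?_).resolve_left (mul_ne_zero hη hs0)
    generalize √(a * b) = t at hβ hs hs0 ⊢
    rw [hβ, ← hs] at hcoeff₃
    rw [hβ, ← hs]
    field_simp
    linear_combination -hcoeff₃
  · rw [hβ, mul_div_cancel_right₀ _ hs0]
    exact (mul_eq_zero.1 hcoeff₁).resolve_left hα

theorem IsState.exists_isFreeGIG (hφ : IsState φ) (hX : 0 ≤ X) (hα : 0 < α) (hβ : 0 < β)
    (hl : 0 ≤ l) (hquad : ∀ᶠ u in 𝓝 0, gigQuadratic α l β k u (momentGF φ X u) = 0) :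
    ∃ μ : Measure ℝ, IsFreeGIG μ (1 - l) α β ∧ HasDistribution φ X μ := by
  obtain ⟨a, b, η, ha, hab, hη, hβη, hdiscr⟩ := hφ.exists_gigDiscr_eq hX hα hβ hl hquad
  obtain ⟨heq₁, heq₂⟩ := gig_equations_of_gigDiscr_eq ha hab hα.ne' hη.ne' hβη hdiscr
  have hab0 : 0 < a * b := mul_pos ha (ha.trans hab)
  have hs0 : √(a * b) ≠ 0 := (Real.sqrt_pos.2 hab0).ne'
  refine ⟨gigMeasure a b α η, ⟨hα, hβ, a, b, ha, hab, by linarith, by linarith, ?_⟩,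
    hφ.hasDistribution_gigMeasure hX.isSelfAdjoint ha hab.le hα hη.le hβη ?_ hdiscr hquad⟩
  · simp only [gigMeasure, gigDensity, hβη, mul_comm η, mul_div_mul_left _ _ hs0]
  · have hratio : β * ((a + b) / (2 * (a * b))) = η * ((a + b) / 2) / √(a * b) := by
      rw [hβη, ← Real.sq_sqrt hab0.le, Real.sqrt_sq (Real.sqrt_nonneg _)]
      field_simp
    linarith

end Roots

section VonNeumann

variable {H : Type*} [NormedAddCommGroup H] [InnerProductSpace ℂ H] [CompleteSpace H]

theorem mem_of_forall_commute {M : VonNeumannAlgebra H} {T : H →L[ℂ] H}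
    (hT : ∀ R ∈ M.commutant, Commute T R) : T ∈ M := by
  rw [← M.commutant_commutant, VonNeumannAlgebra.mem_commutant_iff]
  exact fun R hR => (hT R hR).symm.eq

theorem isClosed_toStarSubalgebra (M : VonNeumannAlgebra H) :
    IsClosed (M.toStarSubalgebra : Set (H →L[ℂ] H)) := by
  rw [M.coe_toStarSubalgebra, ← M.centralizer_centralizer]
  exact Set.isClosed_centralizer _

theorem starOrderedRing_toStarSubalgebra (M : VonNeumannAlgebra H) :
    StarOrderedRing M.toStarSubalgebra := by
  refine StarOrderedRing.of_nonneg_iff' (fun hxy z => ?_) fun x => ⟨fun hx => ?_, ?_⟩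
  · exact add_le_add_right (α := H →L[ℂ] H) hxy z.1
  · have hmem : CFC.sqrt (x : H →L[ℂ] H) ∈ M := mem_of_forall_commute fun R hR =>
      Commute.cfcₙ_nnreal (VonNeumannAlgebra.mem_commutant_iff.1 hR x x.2) NNReal.sqrt
    refine ⟨⟨_, hmem⟩, Subtype.ext ?_⟩
    change (x : H →L[ℂ] H) = star (CFC.sqrt (x : H →L[ℂ] H)) * CFC.sqrt (x : H →L[ℂ] H)
    rw [(CFC.sqrt_nonneg _).isSelfAdjoint.star_eq, CFC.sqrt_mul_sqrt_self (x : H →L[ℂ] H) hx]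
  · rintro ⟨s, rfl⟩
    exact star_mul_self_nonneg (s : H →L[ℂ] H)

variable {M N : VonNeumannAlgebra H}

theorem coe_inverse_mem {a : M.toStarSubalgebra} (ha : (a : H →L[ℂ] H) ∈ N) (hu : IsUnit a) :
    ((a⁻¹ʳ : M.toStarSubalgebra) : H →L[ℂ] H) ∈ N := by
  refine mem_of_forall_commute fun R hR => ?_
  have hcomm : Commute (a : H →L[ℂ] H) R := VonNeumannAlgebra.mem_commutant_iff.1 hR _ ha
  obtain ⟨u, rfl⟩ := hu
  rw [Ring.inverse_unit]
  exact Commute.units_inv_left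
    (u := Units.map (M.toStarSubalgebra.subtype : M.toStarSubalgebra →* (H →L[ℂ] H)) u) hcomm

theorem self_mem_generatedBy (T : H →L[ℂ] H) : T ∈ generatedBy T :=
  StarAlgebra.adjoin_le_centralizer_centralizer ℂ {T}
    (StarAlgebra.self_mem_adjoin_singleton ℂ T)

attribute [local instance] isClosed_toStarSubalgebra

theorem IsCondExp.hasConstantRegression {φ : M.toStarSubalgebra →ₗ[ℂ] ℂ}
    {E : M.toStarSubalgebra →ₗ[ℂ] M.toStarSubalgebra} (hE : IsCondExp φ N E)
    {V S : M.toStarSubalgebra} {r : ℝ} (hV : E V = (r : ℂ) • 1) (hS : (S : H →L[ℂ] H) ∈ N) :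
    HasConstantRegression φ V S r := fun T hT => by
  have hclosed : IsClosed (N.toStarSubalgebra.toSubalgebra.comap
      M.toStarSubalgebra.subtype.toAlgHom : Set M.toStarSubalgebra) :=
    (isClosed_toStarSubalgebra N).preimage continuous_subtype_val
  have hTN : (T : H →L[ℂ] H) ∈ N := Algebra.elemental.le_of_mem hclosed hS hT
  have hbimodule := hE.bimodule 1 V T (one_mem N) hTN
  rw [one_mul, one_mul, hV, smul_mul_assoc, one_mul] at hbimodule
  rw [← hE.preserves, hbimodule, map_smul, smul_eq_mul]

end VonNeumann

end FreeMY

end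

theorem theorem4p1_general {A : Type*} [CStarAlgebra A] [PartialOrder A] [StarOrderedRing A]
    {φ : A →ₗ[ℂ] ℂ} {X Y : A} {c d : ℝ} (h : FreeMY.IsMatsumotoYorPair φ X Y c d)
    (hY : FreeMY.NonDegenerate φ Y) :
    1 < c * d ∧
    ∃ δ₀ lam α β : ℝ, 0 < δ₀ ∧ φ (Ring.inverse Y) = (δ₀ : ℂ) ∧
      lam = c * d / (c * d - 1) ∧ α = δ₀ / (c * d - 1) ∧ β = d / (c * d - 1) ∧
      FreeMY.HasDistribution φ Y (FreeMY.freePoisson lam (1 / α)) ∧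
      ∃ μ : MeasureTheory.Measure ℝ, FreeMY.IsFreeGIG μ (-lam) α β ∧
        FreeMY.HasDistribution φ X μ := by
  have hφ := h.isState
  have hcd := h.one_lt_mul hY
  have hcd0 : 0 < c * d - 1 := sub_pos.2 hcd
  have hδ := hφ.re_pos h.right_pos.ringInverse
  have hd := h.inverse_regression.pos hφ h.left_pos h.right_pos
  have hlam : 1 < c * d / (c * d - 1) := (one_lt_div hcd0).2 (sub_one_lt _)
  have hα := div_pos hδ hcd0
  have hright := h.eventually_gigQuadratic_right hcd0.ne'
  have hleft := h.eventually_gigQuadratic_left hcd0.ne'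
  obtain ⟨μ, hμ, hXμ⟩ := hφ.exists_isFreeGIG h.left_pos.nonneg hα (div_pos hd hcd0)
    (by linarith) hleft
  rw [sub_add_cancel_left] at hμ
  exact ⟨hcd, _, _, _, _, hδ, hφ.eq_re_of_isSelfAdjoint h.right_pos.ringInverse.isSelfAdjoint,
    rfl, rfl, rfl, hφ.hasDistribution_freePoisson h.right_pos.isSelfAdjoint hlam hα hright,
    μ, hμ, hXμ⟩

theorem theorem4p1 {H : Type*} [NormedAddCommGroup H] [InnerProductSpace ℂ H] [CompleteSpace H]
    (M : VonNeumannAlgebra H) (φ : M.toStarSubalgebra →ₗ[ℂ] ℂ)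
    (hφ : FreeMY.IsFaithfulNormalTracialState φ)
    (X Y U V : M.toStarSubalgebra)
    (hX : IsStrictlyPositive X) (hY : IsStrictlyPositive Y)
    (hfree : FreeMY.Free φ X Y)
    (hXnd : FreeMY.NonDegenerate φ X) (hYnd : FreeMY.NonDegenerate φ Y)
    (hU : U = Ring.inverse (X + Y)) (hV : V = Ring.inverse X - Ring.inverse (X + Y))
    (E : M.toStarSubalgebra →ₗ[ℂ] M.toStarSubalgebra)
    (hE : FreeMY.IsCondExp φ (FreeMY.generatedBy (U : H →L[ℂ] H)) E)
    (c d : ℝ)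
    (hc : E V = (c : ℂ) • (1 : M.toStarSubalgebra))
    (hd : E (Ring.inverse V) = (d : ℂ) • (1 : M.toStarSubalgebra)) :
    1 < c * d ∧
    ∃ δ₀ lam α β : ℝ, 0 < δ₀ ∧ φ (Ring.inverse Y) = (δ₀ : ℂ) ∧
      lam = c * d / (c * d - 1) ∧ α = δ₀ / (c * d - 1) ∧ β = d / (c * d - 1) ∧
      FreeMY.HasDistribution φ Y (FreeMY.freePoisson lam (1 / α)) ∧
      ∃ μ : MeasureTheory.Measure ℝ, FreeMY.IsFreeGIG μ (-lam) α β ∧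
        FreeMY.HasDistribution φ X μ := by
  have := FreeMY.isClosed_toStarSubalgebra M
  have := FreeMY.starOrderedRing_toStarSubalgebra M
  have hS : IsUnit (X + Y) := (hX.add_nonneg hY.nonneg).isUnit
  have hSmem : ((X + Y : M.toStarSubalgebra) : H →L[ℂ] H) ∈ FreeMY.generatedBy (U : H →L[ℂ] H) := by
    rw [← Ring.inverse_inverse hS, ← hU]
    exact FreeMY.coe_inverse_mem (FreeMY.self_mem_generatedBy _) (hU ▸ hS.ringInverse)
  exact theorem4p1_general ⟨hφ.isState, hφ.tracial, hX, hY, hfree,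
    hV ▸ hE.hasConstantRegression hc hSmem, hV ▸ hE.hasConstantRegression hd hSmem⟩ hYnd
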